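/- There is an absolute constant $c$ such that the following holds for every simple graph $G$. (1) If $G$ has no induced cycle of length divisible by $3$ (that is, for no $k\ge 3$ with $3\mid k$ is the cycle $C_k$ an induced subgraph of $G$; in particular $G$ is triangle-free), then $\chi(G)\le c$. (2) If $\chi(G)>c$, then $G$ has a finite induced subgraph $H$ with $bn(H)>1$. Here, for a finite graph $H$, the independence complex $\mathcal I(H)$ is the simplicial complex whose faces are the stable sets of $H$ (including the empty set), and $bn(H)$ is the sum of all reduced Betti numbers of $\mathcal I(H)$, that is, $bn(H)=\sum_{i\ge -1}\operatorname{rank}\tilde H_i(\mathcal I(H);\mathbb Z)$, where $\tilde H_i$ is the homology of the augmented simplicial chain complex. -/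

import Mathlib

namespace SimpleGraph

universe u

/-- A trinity graph: no induced cycle has length divisible by `3`.
(The cycle of length `k` is `cycleGraph k` with `3 ≤ k`; `A ⊴ B` is induced containment.) -/
def IsTrinity {V : Type u} (G : SimpleGraph V) : Prop :=
  ∀ k : ℕ, 3 ≤ k → 3 ∣ k → ¬ (cycleGraph k).IsIndContained G

/-- The faces with exactly `k` vertices (that is, of dimension `k - 1`) of the independence
complex of `G`: the stable sets of size `k`. For `k = 0` there is one such face, the empty set. -/
def IndepFace {V : Type u} (G : SimpleGraph V) (k : ℕ) : Type u :=
  {s : Finset V // G.IsIndepSet (s : Set V) ∧ s.card = k}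

/-- The facet of a face obtained by deleting one of its vertices. -/
def IndepFace.erase {V : Type u} [DecidableEq V] {G : SimpleGraph V} {k : ℕ}
    (s : G.IndepFace (k + 1)) (v : V) (hv : v ∈ s.1) : G.IndepFace k :=
  ⟨s.1.erase v,
    s.2.1.mono (by exact_mod_cast Finset.erase_subset v s.1),
    by rw [Finset.card_erase_of_mem hv, s.2.2]; rfl⟩

/-- The group of simplicial chains, with integer coefficients, on the faces with `k` vertices. -/
abbrev IndepChain {V : Type u} (G : SimpleGraph V) (k : ℕ) : Type u :=
  G.IndepFace k →₀ ℤ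

/-- The simplicial boundary map
`∂ [v₀ < ⋯ < v_k] = ∑ i, (-1) ^ i • [v₀, …, v_{i-1}, v_{i+1}, …, v_k]` of the augmented chain
complex (for `k = 0` it is the augmentation `[v₀] ↦ [∅]`). The position `i` of the vertex `v` in
the face `s` is the number of vertices of `s` smaller than `v`. -/
noncomputable def indepBoundary {V : Type u} [LinearOrder V] (G : SimpleGraph V) (k : ℕ) :
    G.IndepChain (k + 1) →ₗ[ℤ] G.IndepChain k :=
  Finsupp.linearCombination ℤ fun s : G.IndepFace (k + 1) =>
    ∑ v ∈ s.1.attach, Finsupp.single (s.erase v.1 v.2) ((-1 : ℤ) ^ (s.1.filter (· < v.1)).card)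

/-- The cycles of the augmented chain complex. -/
noncomputable def indepCycles {V : Type u} [LinearOrder V] (G : SimpleGraph V) :
    (k : ℕ) → Submodule ℤ (G.IndepChain k)
  | 0 => ⊤
  | k + 1 => LinearMap.ker (G.indepBoundary k)

/-- The reduced Betti number in dimension `k - 1` of the independence complex of `G`: the rank of
the reduced homology group `ker ∂ / im ∂` at the faces with `k` vertices. -/
noncomputable def indepBetti {V : Type u} [LinearOrder V] (G : SimpleGraph V) (k : ℕ) : ℕ :=
  Module.finrank ℤ (G.indepCycles k ⧸
    (LinearMap.range (G.indepBoundary k)).submoduleOf (G.indepCycles k))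

/-- `bn(G)`: the sum of all reduced Betti numbers of the independence complex of the finite
graph `G` (a face has at most `|V|` vertices). The order on `V` only serves to orient the faces. -/
noncomputable def bettiSum {V : Type u} [LinearOrder V] [Fintype V] (G : SimpleGraph V) : ℕ :=
  ∑ k ∈ Finset.range (Fintype.card V + 1), G.indepBetti k

end SimpleGraph

/-!
# Graphs without induced cycles of length divisible by three have bounded chromatic number

A graph without holes of length `0` modulo three is called a trinity graph; it is triangle-free.
Beyond that, the assumption enters in one way only: two induced paths between the same nonadjacent
vertices, with anticomplete interiors, have lengths whose sum is not divisible by three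
(`IsTrinity.not_dvd_of_paths`). Let `U`, `B`, `L` be consecutive parts of a breadth-first search:
`L` is a level, `B` (the hubs) is the level before it, and `U` consists of all earlier levels.

*Gadgets and rows.* Suppose that all balls of radius two have bounded chromatic number while `L` has
large chromatic number. Inside `L` there are induced paths of all residues modulo three from a
vertex `z` to a vertex attached to a set that still has large chromatic number
(`IsTrinity.exists_fullGadget`). If `z` is a neighbour of a hub, then every hub touching what is
left must touch the gadget, for otherwise two hubs would be linked through `U`, and through the
gadget by a path of any residue. So the gadget is a *row*, and repetition gives five pairwise
anticomplete connected rows, all touched by every hub that touches the remaining set `E`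
(`IsTrinity.exists_rows`).

*Ported hubs.* A recursive colouring of `E` (`IsTrinity.colOn_of_not_ported`) either has a bounded
number of colours or produces seventeen hubs, pairwise without common neighbours, and a connected
set `Z ⊆ E` that they do not touch but to each of which a neighbour in `E` leads. This is impossible
(`IsTrinity.not_isPorted`). Two nonadjacent hubs are linked through every row, and the lengths in
all rows but at most one are the same nonzero residue `σ`. Since `R(3, 3, 3) = 17` and there are no
triangles, three nonadjacent hubs `a`, `b`, `c` have the same `σ`. In two rows not excepted, one can
arrange that `a`, `b` are linked in one row without touching `c` and `b`, `c` in the other without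
touching `a`. A link of `a` and `c` that avoids `b` and the rows then has length `l` with
`l + σ ≢ 0` and `l + 2 σ ≢ 0`, hence `l ≡ 0`; but there are two such links, one through `Z` and one
through `U`, and their lengths sum to `0` (`IsTrinity.false_of_linkType`).

*Picking hubs.* When balls of radius three have bounded chromatic number, hubs without common
neighbours are found greedily. For the third level it is enough that balls of radius two are
bounded: the neighbourhoods of hubs in the first level are laminar, and a hub with a minimal
neighbourhood is picked (`IsTrinity.colOn_level_three`). As a ball of radius three consists of
neighbours, a ball of radius two and part of a third level, bounded balls of radius two suffice for
the whole graph (`IsTrinity.colOn_univ_of_ballTwo`). The second neighbourhood of a vertex has no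
cycle of length five (`IsTrinity.no_five_cycle`), so within it balls of radius two are stable and
the theorem just described bounds its chromatic number; a second application bounds that of any
finite trinity graph. Infinite graphs follow from the theorem of de Bruijn and Erdős.

*Betti numbers.* A graph of larger chromatic number contains an induced cycle of length divisible by
three, and the independence complex of such a cycle has reduced Euler characteristic `± 2`
(`one_lt_bettiSum_cycleGraph`), which is a lower bound for the sum of the reduced Betti numbers.
-/

namespace SimpleGraph

variable {V : Type*} {G : SimpleGraph V}

/-! ### Restriction, connectedness, colourings of vertex sets -/

/-- The graph on all of `V` keeping only the edges with both ends in `S`. Distances inside `S` are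
distances in `G.within S`. -/
def within (G : SimpleGraph V) (S : Set V) : SimpleGraph V where
  Adj x y := G.Adj x y ∧ x ∈ S ∧ y ∈ S
  symm := ⟨fun _ _ h => ⟨h.1.symm, h.2.2, h.2.1⟩⟩
  loopless := ⟨fun _ h => G.irrefl h.1⟩

/-- `S` induces a connected (or empty) subgraph. -/
def ConnOn (G : SimpleGraph V) (S : Set V) : Prop :=
  ∀ a ∈ S, ∀ b ∈ S, (G.within S).Reachable a b

/-- `S` induces an `n`-colourable subgraph. -/
def ColOn (G : SimpleGraph V) (S : Set V) (n : ℕ) : Prop :=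
  ∃ c : V → ℕ, (∀ x ∈ S, c x < n) ∧ ∀ x ∈ S, ∀ y ∈ S, G.Adj x y → c x ≠ c y

/-- `S` and `T` are disjoint and no edge joins them. -/
def Anticomplete (G : SimpleGraph V) (S T : Set V) : Prop :=
  ∀ s ∈ S, ∀ t ∈ T, s ≠ t ∧ ¬ G.Adj s t

/-- There is an induced path from `a` to `b` with `n` edges, all of whose vertices lie in `S`. -/
def IndPath (G : SimpleGraph V) (S : Set V) (a b : V) (n : ℕ) : Prop :=
  ∃ f : ℕ → V, f 0 = a ∧ f n = b ∧ (∀ i ≤ n, f i ∈ S) ∧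
    (∀ i ≤ n, ∀ j ≤ n, f i = f j → i = j) ∧
    ∀ i ≤ n, ∀ j ≤ n, G.Adj (f i) (f j) ↔ (i + 1 = j ∨ j + 1 = i)

lemma Anticomplete.symm {S T : Set V} (h : G.Anticomplete S T) : G.Anticomplete T S :=
  fun t ht s hs => ⟨(h s hs t ht).1.symm, fun e => (h s hs t ht).2 e.symm⟩

lemma Anticomplete.mono {S T S' T' : Set V} (h : G.Anticomplete S T) (hS : S' ⊆ S)
    (hT : T' ⊆ T) : G.Anticomplete S' T' :=
  fun s hs t ht => h s (hS hs) t (hT ht)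

lemma within_le_within {S T : Set V} (h : S ⊆ T) : G.within S ≤ G.within T :=
  fun _ _ e => ⟨e.1, h e.2.1, h e.2.2⟩

lemma reachable_within_mono {S T : Set V} (h : S ⊆ T) {a b : V}
    (hr : (G.within S).Reachable a b) : (G.within T).Reachable a b :=
  hr.mono (within_le_within h)

lemma reachable_within_adj {S : Set V} {a b : V} (ha : a ∈ S) (hb : b ∈ S) (h : G.Adj a b) :
    (G.within S).Reachable a b :=
  Adj.reachable (G := G.within S) ⟨h, ha, hb⟩

lemma mem_of_reachable_within {S : Set V} {a b : V} (h : (G.within S).Reachable a b)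
    (ha : a ∈ S) : b ∈ S := by
  obtain ⟨w⟩ := h
  induction w with
  | nil => exact ha
  | cons e _ ih => exact ih e.2.2

lemma ConnOn.union {S T : Set V} (hS : G.ConnOn S) (hT : G.ConnOn T) {z : V} (hzS : z ∈ S)
    (hzT : z ∈ T) : G.ConnOn (S ∪ T) := by
  have key : ∀ a ∈ S ∪ T, (G.within (S ∪ T)).Reachable a z := by
    rintro a (ha | ha)
    · exact reachable_within_mono Set.subset_union_left (hS a ha z hzS)
    · exact reachable_within_mono Set.subset_union_right (hT a ha z hzT)
  exact fun a ha b hb => (key a ha).trans (key b hb).symm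

lemma ConnOn.insert_of_adj {S : Set V} (hS : G.ConnOn S) {z x : V} (hx : x ∈ S) (hzx : G.Adj z x) :
    G.ConnOn (insert z S) := by
  have key : ∀ a ∈ insert z S, (G.within (insert z S)).Reachable a x := by
    rintro a (rfl | ha)
    · exact reachable_within_adj (Or.inl rfl) (Or.inr hx) hzx
    · exact reachable_within_mono (Set.subset_insert _ _) (hS a ha x hx)
  exact fun a ha b hb => (key a ha).trans (key b hb).symm

/-! ### Colouring lemmas -/

lemma ColOn.mono {S T : Set V} {m n : ℕ} (h : G.ColOn T n) (hS : S ⊆ T) (hmn : n ≤ m) :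
    G.ColOn S m := by
  obtain ⟨c, h1, h2⟩ := h
  exact ⟨c, fun x hx => (h1 x (hS hx)).trans_le hmn,
    fun x hx y hy => h2 x (hS hx) y (hS hy)⟩

lemma ColOn.union {S T : Set V} {m n : ℕ} (hS : G.ColOn S m) (hT : G.ColOn T n) :
    G.ColOn (S ∪ T) (m + n) := by
  classical
  obtain ⟨c, h1, h2⟩ := hS
  obtain ⟨d, h3, h4⟩ := hT
  refine ⟨fun x => if x ∈ S then c x else m + d x, ?_, ?_⟩
  · rintro x hx
    by_cases hxS : x ∈ S
    · simp only [hxS, if_true]; have := h1 x hxS; omega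
    · have := h3 x (hx.resolve_left hxS)
      simp only [hxS, if_false]; omega
  · intro x hx y hy e
    by_cases hxS : x ∈ S <;> by_cases hyS : y ∈ S <;> simp only [hxS, hyS, if_true, if_false]
    · exact h2 x hxS y hyS e
    · have := h1 x hxS; omega
    · have := h1 y hyS; omega
    · have := h4 x (hx.resolve_left hxS) y (hy.resolve_left hyS) e; omega

lemma ColOn.of_indep {S : Set V} (h : ∀ x ∈ S, ∀ y ∈ S, ¬ G.Adj x y) : G.ColOn S 1 :=
  ⟨fun _ => 0, fun _ _ => Nat.zero_lt_one, fun x hx y hy e => (h x hx y hy e).elim⟩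

lemma ColOn.biUnion_fin {ι : Type*} (F : Finset ι) (X : ι → Set V) {K : ℕ}
    (h : ∀ i ∈ F, G.ColOn (X i) K) : G.ColOn (⋃ i ∈ F, X i) (F.card * K) := by
  classical
  induction F using Finset.induction_on with
  | empty => exact ⟨fun _ => 0, by simp, by simp⟩
  | insert a F ha ih =>
    rw [Finset.card_insert_of_notMem ha, Finset.set_biUnion_insert]
    have := (h a (Finset.mem_insert_self a F)).union
      (ih fun i hi => h i (Finset.mem_insert_of_mem hi))
    exact this.mono subset_rfl (by ring_nf; omega)

/-- Colourings of the connected components of `S` that obey a list constraint `Q` combine to a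
colouring of `S`. -/
lemma exists_coloring_of_components {S : Set V} {Q : V → ℕ → Prop}
    (h : ∀ C ⊆ S, G.ConnOn C → (∀ x ∈ C, ∀ y ∈ S, G.Adj x y → y ∈ C) → C.Nonempty →
      ∃ c : V → ℕ, (∀ x ∈ C, Q x (c x)) ∧ ∀ x ∈ C, ∀ y ∈ C, G.Adj x y → c x ≠ c y) :
    ∃ c : V → ℕ, (∀ x ∈ S, Q x (c x)) ∧ ∀ x ∈ S, ∀ y ∈ S, G.Adj x y → c x ≠ c y := by
  classical
  let comp : (G.within S).ConnectedComponent → Set V :=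
    fun k => {x | x ∈ S ∧ (G.within S).connectedComponentMk x = k}
  have hcl : ∀ k, ∀ x ∈ comp k, ∀ y ∈ S, G.Adj x y → y ∈ comp k := by
    rintro k x ⟨hx, rfl⟩ y hy e
    exact ⟨hy, ConnectedComponent.sound (reachable_within_adj hy hx e.symm)⟩
  have hconn : ∀ k, G.ConnOn (comp k) := by
    rintro k a ⟨ha, rfl⟩ b ⟨hb, hab⟩
    obtain ⟨w⟩ := (ConnectedComponent.exact hab).symm
    have : ∀ (u v : V) (w : (G.within S).Walk u v), u ∈ S →
        (G.within (comp ((G.within S).connectedComponentMk v))).Reachable u v := by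
      intro u v w
      induction w with
      | nil => intro _; exact Reachable.refl _
      | @cons u x v e w ih =>
        intro hu
        have hx : x ∈ S := e.2.2
        refine Reachable.trans ?_ (ih hx)
        refine reachable_within_adj ⟨hu, ?_⟩ ⟨hx, ConnectedComponent.sound w.reachable⟩ e.1
        exact ConnectedComponent.sound ((Adj.reachable e).trans w.reachable)
    have h2 := this a b w ha
    rwa [hab] at h2
  have hcol : ∀ k, ∃ c : V → ℕ, (∀ x ∈ comp k, Q x (c x)) ∧
      ∀ x ∈ comp k, ∀ y ∈ comp k, G.Adj x y → c x ≠ c y := by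
    intro k
    by_cases hne : (comp k).Nonempty
    · exact h (comp k) (fun x hx => hx.1) (hconn k) (hcl k) hne
    · rw [Set.not_nonempty_iff_eq_empty] at hne
      exact ⟨fun _ => 0, by simp [hne], by simp [hne]⟩
  choose c hc1 hc2 using hcol
  refine ⟨fun x => c ((G.within S).connectedComponentMk x) x, fun x hx => hc1 _ x ⟨hx, rfl⟩, ?_⟩
  intro x hx y hy e
  have hxy := hcl _ x ⟨hx, rfl⟩ y hy e
  have := hc2 _ x ⟨hx, rfl⟩ y hxy e
  show c _ x ≠ c _ y
  rwa [hxy.2]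

/-- A set of large chromatic number has a connected component of large chromatic number. -/
lemma exists_big_component {S : Set V} {n : ℕ} (h : ¬ G.ColOn S n) :
    ∃ C ⊆ S, G.ConnOn C ∧ (∀ x ∈ C, ∀ y ∈ S, G.Adj x y → y ∈ C) ∧ C.Nonempty ∧ ¬ G.ColOn C n := by
  by_contra hcon
  push Not at hcon
  exact h (exists_coloring_of_components (Q := fun _ k => k < n)
    fun C h1 h2 h3 h4 => hcon C h1 h2 h3 h4)

lemma ConnOn.exists_edge_leaving {C C' : Set V} (hC : G.ConnOn C) (hsub : C' ⊆ C)
    (hne : C'.Nonempty) {v : V} (hv : v ∈ C) (hv' : v ∉ C') :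
    ∃ x ∈ C', ∃ y ∈ C, y ∉ C' ∧ G.Adj x y := by
  obtain ⟨x, hx⟩ := hne
  obtain ⟨w⟩ := hC x (hsub hx) v hv
  have : ∀ (u v : V) (w : (G.within C).Walk u v), u ∈ C' → v ∉ C' →
      ∃ x ∈ C', ∃ y ∈ C, y ∉ C' ∧ G.Adj x y := by
    intro u v w
    induction w with
    | nil => intro h1 h2; exact (h2 h1).elim
    | @cons u x v e w ih =>
      intro h1 h2
      by_cases hx : x ∈ C'
      · exact ih hx h2
      · exact ⟨u, h1, x, e.2.2, hx, e.1⟩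
  exact this x v w hx hv'

/-- Removing from a connected set `C` a part `X` of bounded chromatic number leaves a connected
set of large chromatic number, attached to a removed vertex. -/
lemma ConnOn.exists_cut {C X : Set V} {M K : ℕ} (hC : G.ConnOn C) (hX : (C ∩ X).Nonempty)
    (hK : G.ColOn (C ∩ X) K) (hbig : ¬ G.ColOn C (M + K)) :
    ∃ C' ⊆ C \ X, G.ConnOn C' ∧ ¬ G.ColOn C' M ∧ C'.Nonempty ∧
      ∃ v ∈ C ∩ X, ∃ x ∈ C', G.Adj v x := by
  have h1 : ¬ G.ColOn (C \ X) M := by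
    intro h
    refine hbig ((h.union hK).mono ?_ le_rfl)
    intro x hx
    by_cases hxX : x ∈ X
    · exact Or.inr ⟨hx, hxX⟩
    · exact Or.inl ⟨hx, hxX⟩
  obtain ⟨C', hsub, hconn, hcl, hne, hcol⟩ := exists_big_component h1
  obtain ⟨v, hv⟩ := hX
  obtain ⟨x, hx, y, hy, hy', e⟩ := hC.exists_edge_leaving (C' := C')
    (fun x hx => (hsub hx).1) hne hv.1 (fun h => (hsub h).2 hv.2)
  refine ⟨C', hsub, hconn, hcol, hne, y, ⟨hy, ?_⟩, x, hx, e.symm⟩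
  by_contra hyX
  exact hy' (hcl x hx y ⟨hy, hyX⟩ e)

/-! ### Induced paths -/

lemma IndPath.mono {S T : Set V} {a b : V} {n : ℕ} (h : G.IndPath S a b n) (hST : S ⊆ T) :
    G.IndPath T a b n := by
  obtain ⟨f, h0, hn, hS, hi, ha⟩ := h
  exact ⟨f, h0, hn, fun i hi => hST (hS i hi), hi, ha⟩

lemma IndPath.symm {S : Set V} {a b : V} {n : ℕ} (h : G.IndPath S a b n) :
    G.IndPath S b a n := by
  obtain ⟨f, h0, hn, hS, hi, ha⟩ := h
  refine ⟨fun i => f (n - i), by simpa using hn, by simpa using h0, fun i _ => hS _ (by omega),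
    fun i hin j hj e => ?_, fun i hin j hj => ?_⟩
  · have := hi _ (by omega) _ (by omega) e; omega
  · rw [ha _ (by omega) _ (by omega)]; omega

lemma IndPath.left_mem {S : Set V} {a b : V} {n : ℕ} (h : G.IndPath S a b n) : a ∈ S := by
  obtain ⟨f, h0, hn, hS, hi, ha⟩ := h
  exact h0 ▸ hS 0 (Nat.zero_le _)

lemma IndPath.right_mem {S : Set V} {a b : V} {n : ℕ} (h : G.IndPath S a b n) : b ∈ S :=
  h.symm.left_mem

lemma IndPath.refl {S : Set V} {a : V} (ha : a ∈ S) : G.IndPath S a a 0 :=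
  ⟨fun _ => a, rfl, rfl, fun _ _ => ha, fun i hi j hj _ => by omega,
    fun i hi j hj => by simp; omega⟩

lemma IndPath.edge {S : Set V} {a b : V} (ha : a ∈ S) (hb : b ∈ S) (e : G.Adj a b) :
    G.IndPath S a b 1 := by
  refine ⟨fun i => if i = 0 then a else b, rfl, rfl, ?_, ?_, ?_⟩
  · intro i _; by_cases h : i = 0 <;> simp [h, ha, hb]
  · intro i hi j hj
    have := e.ne
    interval_cases i <;> interval_cases j <;> simp_all [eq_comm]
  · intro i hi j hj
    interval_cases i <;> interval_cases j <;> simp [e, e.symm]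

lemma IndPath.two_le {S : Set V} {a b : V} {n : ℕ} (h : G.IndPath S a b n) (hab : a ≠ b)
    (e : ¬ G.Adj a b) : 2 ≤ n := by
  obtain ⟨f, h0, hn, hS, hi, ha⟩ := h
  by_contra hlt
  interval_cases n
  · exact hab (h0.symm.trans hn)
  · exact e (h0 ▸ hn ▸ (ha 0 (by omega) 1 (by omega)).2 (Or.inl rfl))

/-- Two induced paths meeting in `b` only, with no edges between them away from `b`, concatenate
to an induced path. -/
lemma IndPath.concat {S T : Set V} {a b c : V} {n m : ℕ} (h1 : G.IndPath S a b n)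
    (h2 : G.IndPath T b c m) (hST : ∀ s ∈ S, ∀ t ∈ T, s ≠ b → t ≠ b → s ≠ t ∧ ¬ G.Adj s t) :
    G.IndPath (S ∪ T) a c (n + m) := by
  obtain ⟨f, f0, fn, fS, fi, fa⟩ := h1
  obtain ⟨g, g0, gm, gT, gi, ga⟩ := h2
  have fb : ∀ i ≤ n, f i = b → i = n := fun i hi e => fi i hi n le_rfl (e.trans fn.symm)
  have gb : ∀ i ≤ m, g i = b → i = 0 := fun i hi e => gi i hi 0 (Nat.zero_le _) (e.trans g0.symm)
  have hcross : ∀ i ≤ n, ∀ j ≤ m, i ≠ n → j ≠ 0 → f i ≠ g j ∧ ¬ G.Adj (f i) (g j) := by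
    intro i hi j hj h h'
    exact hST _ (fS i hi) _ (gT j hj) (fun e => h (fb i hi e)) (fun e => h' (gb j hj e))
  refine ⟨fun i => if i ≤ n then f i else g (i - n), by simpa using f0, ?_, ?_, ?_, ?_⟩
  · by_cases hm : m = 0
    · subst hm; simp [fn, ← g0, ← gm]
    · simp [show ¬ (n + m ≤ n) by omega, gm]
  · intro i hi
    by_cases h : i ≤ n <;> simp only [h, if_true, if_false]
    · exact Or.inl (fS i h)
    · exact Or.inr (gT _ (by omega))
  · intro i hi j hj
    by_cases h : i ≤ n <;> by_cases h' : j ≤ n <;> simp only [h, h', if_true, if_false]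
    · exact fi i h j h'
    · intro e
      by_cases hin : i = n
      · subst hin
        have := gb _ (by omega) (e.symm.trans fn); omega
      · exact ((hcross i h (j - n) (by omega) hin (by omega)).1 e).elim
    · intro e
      by_cases hjn : j = n
      · subst hjn
        have := gb _ (by omega) (e.trans fn); omega
      · exact ((hcross j h' (i - n) (by omega) hjn (by omega)).1 e.symm).elim
    · intro e; have := gi _ (by omega) _ (by omega) e; omega
  · intro i hi j hj
    by_cases h : i ≤ n <;> by_cases h' : j ≤ n <;> simp only [h, h', if_true, if_false]
    · exact fa i h j h'
    · by_cases hin : i = n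
      · subst hin
        rw [fn, ← g0, ga 0 (by omega) _ (by omega)]; omega
      · have := (hcross i h (j - n) (by omega) hin (by omega)).2
        simp only [this, false_iff]; omega
    · by_cases hjn : j = n
      · subst hjn
        rw [fn, ← g0, ga _ (by omega) 0 (by omega)]; omega
      · have := (hcross j h' (i - n) (by omega) hjn (by omega)).2
        simp only [G.adj_comm, this, false_iff]; omega
    · rw [ga _ (by omega) _ (by omega)]; omega

lemma IndPath.snoc {S : Set V} {a b c : V} {n : ℕ} (h : G.IndPath S a b n) (e : G.Adj b c)
    (hc : ∀ s ∈ S, s ≠ b → s ≠ c ∧ ¬ G.Adj s c) : G.IndPath (insert c S) a c (n + 1) := by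
  have h2 : G.IndPath {b, c} b c 1 := IndPath.edge (by simp) (by simp) e
  refine (h.concat h2 ?_).mono ?_
  · rintro s hs t (rfl | rfl) hsb htb
    · exact (htb rfl).elim
    · exact hc s hs hsb
  · rintro x (hx | rfl | rfl)
    · exact Or.inr hx
    · exact Or.inr h.right_mem
    · exact Or.inl rfl

/-- In a graph without induced cycles of length divisible by three, two induced paths with the same
ends and anticomplete interiors have total length not divisible by three. -/
lemma IsTrinity.not_dvd_of_paths (hG : G.IsTrinity) {S T : Set V} {a b : V} {n m : ℕ}
    (h1 : G.IndPath S a b n) (h2 : G.IndPath T a b m) (hn : 2 ≤ n) (hm : 2 ≤ m)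
    (hST : ∀ s ∈ S, ∀ t ∈ T, s ≠ a → s ≠ b → t ≠ a → t ≠ b → s ≠ t ∧ ¬ G.Adj s t) :
    ¬ 3 ∣ n + m := by
  intro hdvd
  obtain ⟨f, f0, fn, fS, fi, fa⟩ := h1
  obtain ⟨g, g0, gm, gT, gi, ga⟩ := h2
  have hcross : ∀ i ≤ n, ∀ j ≤ m, i ≠ 0 → i ≠ n → j ≠ 0 → j ≠ m →
      f i ≠ g j ∧ ¬ G.Adj (f i) (g j) := by
    intro i hi j hj hi0 hin hj0 hjm
    refine hST _ (fS i hi) _ (gT j hj) ?_ ?_ ?_ ?_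
    · exact fun e => hi0 (fi i hi 0 (by omega) (e.trans f0.symm))
    · exact fun e => hin (fi i hi n (by omega) (e.trans fn.symm))
    · exact fun e => hj0 (gi j hj 0 (by omega) (e.trans g0.symm))
    · exact fun e => hjm (gi j hj m (by omega) (e.trans gm.symm))
  set k := n + m with hk
  let h : ℕ → V := fun i => if i ≤ n then f i else g (k - i)
  have hinj : ∀ i < k, ∀ j < k, h i = h j → i = j := by
    intro i hi j hj
    by_cases hin : i ≤ n <;> by_cases hjn : j ≤ n <;> simp only [h, hin, hjn, if_true, if_false]
    · exact fi i hin j hjn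
    · intro e
      rcases Nat.eq_zero_or_pos i with rfl | hi0
      · rw [f0, ← g0] at e; have := gi _ (by omega) _ (by omega) e; omega
      · by_cases hin' : i = n
        · subst hin'; rw [fn, ← gm] at e; have := gi _ (by omega) _ (by omega) e; omega
        · exact ((hcross i hin (k - j) (by omega) (by omega) hin' (by omega) (by omega)).1 e).elim
    · intro e
      rcases Nat.eq_zero_or_pos j with rfl | hj0
      · rw [f0, ← g0] at e; have := gi _ (by omega) _ (by omega) e; omega
      · by_cases hjn' : j = n
        · subst hjn'; rw [fn, ← gm] at e; have := gi _ (by omega) _ (by omega) e; omega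
        · exact ((hcross j hjn (k - i) (by omega) (by omega) hjn' (by omega) (by omega)).1
            e.symm).elim
    · intro e; have := gi _ (by omega) _ (by omega) e; omega
  have hmix : ∀ i ≤ n, ∀ j < k, n < j →
      (G.Adj (f i) (g (k - j)) ↔ (i + 1 = j ∨ (i = 0 ∧ j + 1 = k))) := by
    intro i hin j hj hjn
    rcases Nat.eq_zero_or_pos i with rfl | hi0
    · rw [f0, ← g0, ga _ (by omega) _ (by omega)]; omega
    · by_cases hin' : i = n
      · subst hin'; rw [fn, ← gm, ga _ (by omega) _ (by omega)]; omega
      · have := (hcross i hin (k - j) (by omega) (by omega) hin' (by omega) (by omega)).2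
        simp only [this, false_iff]; omega
  have hadj : ∀ i < k, ∀ j < k, i < j →
      (G.Adj (h i) (h j) ↔ (i + 1 = j ∨ (i = 0 ∧ j + 1 = k))) := by
    intro i hi j hj hij
    by_cases hin : i ≤ n <;> by_cases hjn : j ≤ n <;> simp only [h, hin, hjn, if_true, if_false]
    · rw [fa i hin j hjn]; omega
    · exact hmix i hin j hj (by omega)
    · omega
    · rw [ga _ (by omega) _ (by omega)]; omega
  refine hG k (by omega) hdvd ⟨⟨⟨fun i => h i.val, ?_⟩, ?_⟩⟩
  · intro i j e
    exact Fin.ext (hinj i i.2 j j.2 e)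
  · intro i j
    rw [cycleGraph_adj']
    change G.Adj (h i) (h j) ↔ _
    rcases lt_trichotomy i j with hij | hij | hij
    · rw [hadj i i.2 j j.2 hij]
      have h1 : (i - j).val = k - (j.val - i.val) := by
        rw [Fin.sub_def]; simp only
        have : i.val < j.val := hij
        have := i.2; have := j.2
        rw [Nat.mod_eq_of_lt (by omega)]; omega
      have h2 : (j - i).val = j.val - i.val := Fin.sub_val_of_le hij.le
      rw [h1, h2]
      have : i.val < j.val := hij
      have := i.2; have := j.2
      omega
    · subst hij
      simp only [SimpleGraph.irrefl, false_iff]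
      have : (i - i).val = 0 := by
        rw [Fin.sub_def]; simp only
        have := i.2
        rw [show k - i.val + i.val = k by omega]; simp
      omega
    · rw [G.adj_comm, hadj j j.2 i i.2 hij]
      have h1 : (j - i).val = k - (i.val - j.val) := by
        rw [Fin.sub_def]; simp only
        have : j.val < i.val := hij
        have := i.2; have := j.2
        rw [Nat.mod_eq_of_lt (by omega)]; omega
      have h2 : (i - j).val = i.val - j.val := Fin.sub_val_of_le hij.le
      rw [h1, h2]
      have : j.val < i.val := hij
      have := i.2; have := j.2
      omega

lemma IsTrinity.not_triangle (hG : G.IsTrinity) {x y z : V} (h1 : G.Adj x y) (h2 : G.Adj y z)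
    (h3 : G.Adj x z) : False := by
  refine hG 3 le_rfl dvd_rfl ⟨⟨⟨![x, y, z], ?_⟩, ?_⟩⟩
  · intro i j
    have := h1.ne; have := h2.ne; have := h3.ne
    fin_cases i <;> fin_cases j <;> simp_all [eq_comm]
  · intro i j
    change G.Adj (![x, y, z] i) (![x, y, z] j) ↔ _
    rw [cycleGraph_three_eq_top]
    fin_cases i <;> fin_cases j <;>
      simp [h1, h2, h3, h1.symm, h2.symm, h3.symm]

/-! ### Breadth-first levels -/

/-- The vertices at distance `j` from `z` in the subgraph induced on `S`. -/
def level (G : SimpleGraph V) (S : Set V) (z : V) (j : ℕ) : Set V :=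
  {x | (G.within S).Reachable z x ∧ (G.within S).dist z x = j}

lemma level_subset {S : Set V} {z : V} (hz : z ∈ S) (j : ℕ) : G.level S z j ⊆ S :=
  fun _ hx => mem_of_reachable_within hx.1 hz

lemma level_inj {S : Set V} {z x : V} {i j : ℕ} (hi : x ∈ G.level S z i)
    (hj : x ∈ G.level S z j) : i = j := hi.2.symm.trans hj.2

lemma level_zero {S : Set V} {z x : V} : x ∈ G.level S z 0 ↔ x = z := by
  constructor
  · rintro ⟨h1, h2⟩
    exact (h1.dist_eq_zero_iff.1 h2).symm
  · rintro rfl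
    exact ⟨Reachable.refl _, dist_self⟩

lemma level_adj_le {S : Set V} {z x y : V} {i j : ℕ} (hz : z ∈ S) (hi : x ∈ G.level S z i)
    (hj : y ∈ G.level S z j) (e : G.Adj x y) : j ≤ i + 1 := by
  have e' : (G.within S).Adj x y := ⟨e, level_subset hz _ hi, level_subset hz _ hj⟩
  have := e'.diff_dist_adj (u := z)
  rw [hi.2, hj.2] at this
  omega

lemma exists_parent {S : Set V} {z x : V} {j : ℕ} (hx : x ∈ G.level S z (j + 1)) :
    ∃ d ∈ G.level S z j, G.Adj d x := by
  obtain ⟨h1, h2⟩ := hx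
  obtain ⟨w, hw⟩ := h1.exists_walk_length_eq_dist
  rw [h2] at hw
  have hnil : ¬ w.Nil := by
    intro h; rw [← Walk.length_eq_zero_iff] at h; omega
  have hadj := w.adj_penultimate hnil
  have hl : w.dropLast.length = j := by
    have := w.length_dropLast_add_one hnil; omega
  have hle := dist_le w.dropLast
  have := hadj.diff_dist_adj (u := z)
  exact ⟨w.penultimate, ⟨w.dropLast.reachable, by omega⟩, hadj.1⟩

/-- Shortest paths are induced, with one vertex in each level. -/
lemma exists_geodesic {S : Set V} {z x : V} {j : ℕ} (hz : z ∈ S) (hx : x ∈ G.level S z j) :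
    ∃ P : Set V, G.IndPath P z x j ∧ P ⊆ S ∧ ∀ p ∈ P, p = x ∨ ∃ i < j, p ∈ G.level S z i := by
  induction j generalizing x with
  | zero =>
    rw [level_zero] at hx
    subst hx
    exact ⟨{x}, IndPath.refl rfl, by simpa using hz, fun p hp => Or.inl hp⟩
  | succ j ih =>
    obtain ⟨d, hd, e⟩ := exists_parent hx
    obtain ⟨P, hP, hPS, hlev⟩ := ih hd
    refine ⟨insert x P, hP.snoc e ?_, Set.insert_subset (level_subset hz _ hx) hPS, ?_⟩
    · intro s hs hsd
      obtain ⟨i, hi, hsi⟩ := (hlev s hs).resolve_left hsd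
      refine ⟨?_, fun e => ?_⟩
      · rintro rfl; have := level_inj hsi hx; omega
      · have := level_adj_le hz hsi hx e; omega
    · rintro p (rfl | hp)
      · exact Or.inl rfl
      · rcases hlev p hp with rfl | ⟨i, hi, hpi⟩
        · exact Or.inr ⟨j, by omega, hd⟩
        · exact Or.inr ⟨i, by omega, hpi⟩

lemma exists_indPath_of_reachable {S : Set V} {a b : V} (ha : a ∈ S)
    (h : (G.within S).Reachable a b) : ∃ n, G.IndPath S a b n := by
  obtain ⟨P, hP, hPS, -⟩ := exists_geodesic (G := G) (x := b) ha ⟨h, rfl⟩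
  exact ⟨_, hP.mono hPS⟩

lemma connOn_image_Iic {f : ℕ → V} {n : ℕ} (h : ∀ i < n, G.Adj (f i) (f (i + 1))) :
    G.ConnOn (f '' Set.Iic n) := by
  have key : ∀ i ≤ n, (G.within (f '' Set.Iic n)).Reachable (f 0) (f i) := by
    intro i
    induction i with
    | zero => intro _; exact Reachable.refl _
    | succ i ih =>
      intro hi
      exact (ih (by omega)).trans (reachable_within_adj ⟨i, by simp; omega, rfl⟩ ⟨i + 1, hi, rfl⟩
        (h i hi))
  rintro _ ⟨i, hi, rfl⟩ _ ⟨j, hj, rfl⟩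
  exact (key i hi).symm.trans (key j hj)

lemma IndPath.exists_connOn {S : Set V} {a b : V} {n : ℕ} (h : G.IndPath S a b n) :
    ∃ P ⊆ S, G.ConnOn P ∧ G.IndPath P a b n := by
  obtain ⟨f, f0, fn, fS, fi, fa⟩ := h
  exact ⟨f '' Set.Iic n, by rintro _ ⟨i, hi, rfl⟩; exact fS i hi,
    connOn_image_Iic fun i hi => (fa i hi.le (i + 1) hi).2 (Or.inl rfl),
    f, f0, fn, fun i hi => ⟨i, hi, rfl⟩, fi, fa⟩

/-- If every level is `N`-colourable, two palettes of `N` colours, used for the levels of even and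
of odd index, suffice for all of them. -/
lemma exists_big_level {S T : Set V} {z : V} {N : ℕ} (hz : z ∈ S)
    (hT : ∀ x ∈ T, (G.within S).Reachable z x) (h : ¬ G.ColOn T (2 * N)) :
    ∃ j, ¬ G.ColOn (G.level S z j) N := by
  by_contra hcon
  push Not at hcon
  choose c hc1 hc2 using hcon
  have hlev : ∀ x ∈ T, x ∈ G.level S z ((G.within S).dist z x) :=
    fun x hx => ⟨hT x hx, rfl⟩
  refine h ⟨fun x => ((G.within S).dist z x % 2) * N + c ((G.within S).dist z x) x, ?_, ?_⟩
  · intro x hx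
    have := hc1 _ x (hlev x hx)
    rcases Nat.mod_two_eq_zero_or_one ((G.within S).dist z x) with h | h <;> simp only [h] <;> omega
  · intro x hx y hy e heq
    have h1 := level_adj_le hz (hlev x hx) (hlev y hy) e
    have h2 := level_adj_le hz (hlev y hy) (hlev x hx) e.symm
    have h3 := hc1 _ x (hlev x hx)
    have h4 := hc1 _ y (hlev y hy)
    by_cases hd : (G.within S).dist z x = (G.within S).dist z y
    · have h5 := hlev y hy
      simp only [hd] at heq
      have h6 := hlev x hx
      rw [hd] at h6
      exact hc2 _ x h6 y h5 e (by omega)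
    · have : (G.within S).dist z x % 2 ≠ (G.within S).dist z y % 2 := by omega
      rcases Nat.mod_two_eq_zero_or_one ((G.within S).dist z x) with h | h <;>
      rcases Nat.mod_two_eq_zero_or_one ((G.within S).dist z y) with h' | h' <;>
        simp only [h, h'] at heq this <;> omega

/-! ### Gadgets -/

/-- The ends of the walks of length two from `v`. -/
def ballTwo (G : SimpleGraph V) (v : V) : Set V := {x | ∃ d, G.Adj v d ∧ G.Adj d x}

lemma IsTrinity.colOn_neighbors (hG : G.IsTrinity) (v : V) : G.ColOn {x | G.Adj v x} 1 :=
  ColOn.of_indep fun _ hx _ hy e => hG.not_triangle hx e hy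

lemma IsTrinity.exists_cut_neighbors (hG : G.IsTrinity) {C : Set V} {M : ℕ} (hC : G.ConnOn C)
    {v x : V} (hx : x ∈ C) (hvx : G.Adj v x) (hbig : ¬ G.ColOn C (M + 1)) :
    ∃ C' ⊆ C, G.ConnOn C' ∧ ¬ G.ColOn C' M ∧ (∀ x ∈ C', ¬ G.Adj v x) ∧
      ∃ v' ∈ C, G.Adj v v' ∧ ∃ x ∈ C', G.Adj v' x := by
  obtain ⟨C', h1, h2, h3, -, v', h4, h5⟩ := hC.exists_cut (X := {x | G.Adj v x}) ⟨x, hx, hvx⟩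
    ((hG.colOn_neighbors v).mono Set.inter_subset_right le_rfl) hbig
  exact ⟨C', fun x hx => (h1 hx).1, h2, h3, fun x hx => (h1 hx).2, v', h4.1, h4.2, h5⟩

/-- From a vertex `z` attached to a connected set `D` of large chromatic number, two induced paths
of lengths distinct modulo three lead to a vertex `y` attached to a connected set `E ⊆ D` that is
still of large chromatic number and has no other edges to the two paths.

A level `k + 2` of the search from `z` has large chromatic number. In it, a path `y₀ y₁ y₂ y` is
found by successive cuts; `y₀` is a grandchild of a vertex `q` of level `k`, through `d₀`, while no
grandchild of `q` is left among the later vertices. If `d` is a parent of `y₂`, the last cut is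
along the neighbours of `y₂` and of `d`, so that `y` is adjacent to exactly one of them. One path to
`y` descends through `d`, the other through `q` and `d₀`.

The bound allows for the `τ` colours of the grandchildren of `q`, one colour each for the
neighbourhoods of `y₀`, `y₁`, `y₂`, `d`, and small levels. -/
lemma IsTrinity.exists_gadget (hG : G.IsTrinity) {τ : ℕ} (hτ : ∀ v, G.ColOn (G.ballTwo v) τ)
    {D : Set V} {z x₀ : V} {N : ℕ} (hD : G.ConnOn D) (hz : z ∉ D) (hx₀ : x₀ ∈ D)
    (hzx : G.Adj z x₀) (hbig : ¬ G.ColOn D (2 * (N + τ + 5))) :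
    ∃ (W : Set V) (y : V) (E : Set V), W ⊆ insert z D ∧ G.ConnOn W ∧ y ∈ W ∧ y ≠ z ∧ E ⊆ D ∧
      G.ConnOn E ∧ ¬ G.ColOn E N ∧ (∃ x ∈ E, G.Adj y x) ∧ y ∉ E ∧
      G.Anticomplete (W \ {y}) E ∧
      ∃ n m, G.IndPath W z y n ∧ G.IndPath W z y m ∧ n % 3 ≠ m % 3 := by
  set S := insert z D with hSdef
  have hzS : z ∈ S := Or.inl rfl
  have hS : G.ConnOn S := hD.insert_of_adj hx₀ hzx
  obtain ⟨j, hj⟩ := exists_big_level hzS (hS z hzS)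
    (fun h => hbig (h.mono (Set.subset_insert _ _) le_rfl))
  -- the large level is at distance at least two
  have hj2 : 2 ≤ j := by
    by_contra hlt
    have : j = 0 ∨ j = 1 := by omega
    rcases this with rfl | rfl
    · refine hj ((ColOn.of_indep fun x hx y hy e => ?_).mono subset_rfl (by omega : 1 ≤ _))
      rw [level_zero] at hx hy
      subst hx; subst hy; exact G.irrefl e
    · refine hj ((hG.colOn_neighbors z).mono ?_ (by omega))
      intro x hx
      obtain ⟨d, hd, e⟩ := exists_parent hx
      rw [level_zero] at hd
      subst hd; exact e
  obtain ⟨K, hKsub, hKc, -, ⟨x, hx⟩, hKbig⟩ := exists_big_component hj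
  have hKD : K ⊆ D := by
    intro u hu
    rcases level_subset hzS _ (hKsub hu) with rfl | h
    · have := level_inj (hKsub hu) (level_zero.2 rfl); omega
    · exact h
  obtain ⟨k, rfl⟩ : ∃ k, j = k + 2 := ⟨j - 2, by omega⟩
  have lev_ne : ∀ {u v : V} {i l : ℕ}, u ∈ G.level S z i → v ∈ G.level S z l → i ≠ l → u ≠ v := by
    rintro u v i l hu hv hil rfl; exact hil (level_inj hu hv)
  have lev_nadj : ∀ {u v : V} {i l : ℕ}, u ∈ G.level S z i → v ∈ G.level S z l → i + 1 < l →
      ¬ G.Adj u v := by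
    intro u v i l hu hv hil e; have := level_adj_le hzS hu hv e; omega
  obtain ⟨d', hd', hd'x⟩ := exists_parent (hKsub hx)
  obtain ⟨q, hq, hqd'⟩ := exists_parent hd'
  set X : Set V := {u | ∃ d ∈ G.level S z (k + 1), G.Adj q d ∧ G.Adj d u} with hX
  obtain ⟨E0, hE0sub, hE0c, hE0big, -, y0, ⟨hy0K, d0, hd0, hqd0, hd0y0⟩, x0, hx0, hy0x0⟩ :=
    hKc.exists_cut (X := X) (M := N + 4) (K := τ) ⟨x, hx, d', hd', hqd', hd'x⟩
      ((hτ q).mono (by rintro u ⟨-, d, -, h1, h2⟩; exact ⟨d, h1, h2⟩) le_rfl)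
      (fun h => hKbig (h.mono subset_rfl (by omega)))
  obtain ⟨E1, hE1sub, hE1c, hE1big, hE1y0, y1, hy1, hy01, x1, hx1, hy1x1⟩ :=
    hG.exists_cut_neighbors hE0c hx0 hy0x0 (M := N + 3) hE0big
  obtain ⟨E2, hE2sub, hE2c, hE2big, hE2y1, y2, hy2, hy12, x2, hx2, hy2x2⟩ :=
    hG.exists_cut_neighbors hE1c hx1 hy1x1 (M := N + 2) hE1big
  have hE0K : E0 ⊆ K := fun u hu => (hE0sub hu).1
  have hE0X : ∀ u ∈ E0, u ∉ X := fun u hu => (hE0sub hu).2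
  have hE2E0 : E2 ⊆ E0 := hE2sub.trans hE1sub
  have hy2E0 : y2 ∈ E0 := hE1sub hy2
  -- the parent `d` of `y2` is not adjacent to `q`, since `y2` is not a grandchild of `q`
  obtain ⟨d, hd, hdy2⟩ := exists_parent (hKsub (hE0K hy2E0))
  obtain ⟨E3, hE3sub, hE3c, hE3big, -, y, ⟨hyE2, hyX⟩, x3, hx3, hyx3⟩ :=
    hE2c.exists_cut (X := {u | G.Adj y2 u} ∪ {u | G.Adj d u}) (M := N) (K := 2)
      ⟨x2, hx2, Or.inl hy2x2⟩
      (((hG.colOn_neighbors y2).union (hG.colOn_neighbors d)).mono Set.inter_subset_right le_rfl)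
      hE2big
  have hE3E2 : E3 ⊆ E2 := fun u hu => (hE3sub hu).1
  have hE3y2 : ∀ u ∈ E3, ¬ G.Adj y2 u := fun u hu h => (hE3sub hu).2 (Or.inl h)
  have hE3d : ∀ u ∈ E3, ¬ G.Adj d u := fun u hu h => (hE3sub hu).2 (Or.inr h)
  have hyE3 : y ∉ E3 := fun h => (hE3sub h).2 hyX
  have hE0lev : ∀ u ∈ E0, u ∈ G.level S z (k + 2) := fun u hu => hKsub (hE0K hu)
  have ly0 := hKsub hy0K
  have ly1 := hE0lev y1 hy1
  have ly2 := hE0lev y2 hy2E0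
  have ly := hE0lev y (hE2E0 hyE2)
  have hd0E0 : ∀ u ∈ E0, ¬ G.Adj d0 u := fun u hu e => hE0X u hu ⟨d0, hd0, hqd0, e⟩
  have hqd : ¬ G.Adj q d := fun e => hE0X y2 hy2E0 ⟨d, hd, e, hdy2⟩
  have hdy1 : ¬ G.Adj d y1 := fun e => hG.not_triangle e hy12 hdy2
  obtain ⟨Q, hQ, hQS, hQlev⟩ := exists_geodesic hzS hq
  obtain ⟨R, hR, hRS, hRlev⟩ := exists_geodesic hzS hd
  obtain ⟨Q, hQQ, hQc, hQ⟩ := hQ.exists_connOn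
  obtain ⟨R, hRR, hRc, hR⟩ := hR.exists_connOn
  replace hQS := hQQ.trans hQS
  replace hRS := hRR.trans hRS
  replace hQlev : ∀ p ∈ Q, p = q ∨ ∃ i < k, p ∈ G.level S z i := fun p hp => hQlev p (hQQ hp)
  replace hRlev : ∀ p ∈ R, p = d ∨ ∃ i < k + 1, p ∈ G.level S z i := fun p hp => hRlev p (hRR hp)
  -- vertices of the geodesics against higher levels
  have hQ1 : ∀ u ∈ G.level S z (k + 1), ∀ p ∈ Q, p ≠ q → p ≠ u ∧ ¬ G.Adj p u := by
    intro u hu p hp hpq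
    obtain ⟨i, hi, hpi⟩ := (hQlev p hp).resolve_left hpq
    exact ⟨lev_ne hpi hu (by omega), lev_nadj hpi hu (by omega)⟩
  have hQ2 : ∀ u ∈ G.level S z (k + 2), ∀ p ∈ Q, p ≠ u ∧ ¬ G.Adj p u := by
    intro u hu p hp
    rcases hQlev p hp with rfl | ⟨i, hi, hpi⟩
    · exact ⟨lev_ne hq hu (by omega), lev_nadj hq hu (by omega)⟩
    · exact ⟨lev_ne hpi hu (by omega), lev_nadj hpi hu (by omega)⟩
  have hR2 : ∀ u ∈ G.level S z (k + 2), ∀ p ∈ R, p ≠ d → p ≠ u ∧ ¬ G.Adj p u := by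
    intro u hu p hp hpd
    obtain ⟨i, hi, hpi⟩ := (hRlev p hp).resolve_left hpd
    exact ⟨lev_ne hpi hu (by omega), lev_nadj hpi hu (by omega)⟩
  have ne_d0 : ∀ u ∈ G.level S z (k + 2), d0 ≠ u := fun u hu => lev_ne hd0 hu (by omega)
  have ne_d : ∀ u ∈ G.level S z (k + 2), d ≠ u := fun u hu => lev_ne hd hu (by omega)
  have hd0d : d0 ≠ d := by rintro rfl; exact hqd hqd0
  have hy0y2 : ¬ G.Adj y0 y2 := hE1y0 y2 hy2
  have hy0y : ¬ G.Adj y0 y := hE1y0 y (hE2sub hyE2)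
  have hy1y : ¬ G.Adj y1 y := hE2y1 y hyE2
  have hd0y1 := hd0E0 y1 hy1
  have hd0y2 := hd0E0 y2 hy2E0
  have hd0y := hd0E0 y (hE2E0 hyE2)
  have hy0E0 : y0 ∉ E0 := fun h => hE0X y0 h ⟨d0, hd0, hqd0, hd0y0⟩
  have ny02 : y0 ≠ y2 := by rintro rfl; exact hy0E0 hy2E0
  have ny0y : y0 ≠ y := by rintro rfl; exact hy0E0 (hE2E0 hyE2)
  have ny1y : y1 ≠ y := by
    rintro rfl; exact hE1y0 y1 (hE2sub hyE2) hy01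
  have ny2y : y2 ≠ y := by
    rintro rfl; exact hE2y1 y2 hyE2 hy12
  -- the path z … q d0 y0
  have P0 : G.IndPath (insert d0 Q) z d0 (k + 1) := hQ.snoc hqd0 (hQ1 d0 hd0)
  have P1 : G.IndPath (insert y0 (insert d0 Q)) z y0 (k + 2) := by
    refine P0.snoc hd0y0 ?_
    rintro s (rfl | hs) hne
    · exact (hne rfl).elim
    · exact hQ2 y0 ly0 s hs
  have P2 : G.IndPath (insert y1 (insert y0 (insert d0 Q))) z y1 (k + 3) := by
    refine P1.snoc hy01 ?_
    rintro s (rfl | rfl | hs) hne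
    · exact (hne rfl).elim
    · exact ⟨ne_d0 y1 ly1, hd0y1⟩
    · exact hQ2 y1 ly1 s hs
  have P3 : G.IndPath (insert y2 (insert y1 (insert y0 (insert d0 Q)))) z y2 (k + 4) := by
    refine P2.snoc hy12 ?_
    rintro s (rfl | rfl | rfl | hs) hne
    · exact (hne rfl).elim
    · exact ⟨ny02, hy0y2⟩
    · exact ⟨ne_d0 y2 ly2, hd0y2⟩
    · exact hQ2 y2 ly2 s hs
  set W : Set V := insert y (insert y2 (insert y1 (insert y0 (insert d0 Q)))) ∪ insert y
    (insert y2 R) with hW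
  have hzQ : z ∈ Q := hQ.left_mem
  have hzR : z ∈ R := hR.left_mem
  have hWE3 : G.Anticomplete (W \ {y}) E3 := by
    rintro s ⟨hs, hsy⟩ t ht
    have htE2 := hE3E2 ht
    have htE0 := hE2E0 htE2
    have lt := hE0lev t htE0
    have hsy : s ≠ y := hsy
    have c2 : y2 ≠ t ∧ ¬ G.Adj y2 t := by
      refine ⟨?_, hE3y2 t ht⟩
      rintro rfl; exact hE2y1 _ htE2 hy12
    rcases hs with (rfl | rfl | rfl | rfl | rfl | hs) | (rfl | rfl | hs)
    · exact (hsy rfl).elim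
    · exact c2
    · refine ⟨?_, hE2y1 t htE2⟩
      rintro rfl; exact hE1y0 _ (hE2sub htE2) hy01
    · refine ⟨?_, hE1y0 t (hE2sub htE2)⟩
      rintro rfl; exact hy0E0 htE0
    · exact ⟨ne_d0 t lt, hd0E0 t htE0⟩
    · exact hQ2 t lt s hs
    · exact (hsy rfl).elim
    · exact c2
    · by_cases hsd : s = d
      · subst hsd
        exact ⟨ne_d t lt, hE3d t ht⟩
      · exact hR2 t lt s hs hsd
  have mem_S : ∀ {u : V} {i : ℕ}, u ∈ G.level S z i → u ∈ S := fun hu => level_subset hzS _ hu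
  have hWS : W ⊆ S := by
    rintro s ((rfl | rfl | rfl | rfl | rfl | hs) | (rfl | rfl | hs))
    exacts [mem_S ly, mem_S ly2, mem_S ly1, mem_S ly0, mem_S hd0, hQS hs, mem_S ly, mem_S ly2,
      hRS hs]
  have hyW : y ∈ W := Or.inl (Or.inl rfl)
  have hyz : y ≠ z := lev_ne ly (level_zero.2 rfl) (by omega)
  have hyD : y ∈ D := hKD (hE0K (hE2E0 hyE2))
  -- all vertices of the gadget can be reached from the start
  have hWc : G.ConnOn W := by
    have hzW : z ∈ W := Or.inr (Or.inr (Or.inr hzR))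
    have m2 : y2 ∈ W := Or.inr (Or.inr (Or.inl rfl))
    have m1 : y1 ∈ W := Or.inl (Or.inr (Or.inr (Or.inl rfl)))
    have m0 : y0 ∈ W := Or.inl (Or.inr (Or.inr (Or.inr (Or.inl rfl))))
    have md0 : d0 ∈ W := Or.inl (Or.inr (Or.inr (Or.inr (Or.inr (Or.inl rfl)))))
    have sQ : Q ⊆ W := fun s hs => Or.inl (Or.inr (Or.inr (Or.inr (Or.inr (Or.inr hs)))))
    have sR : R ⊆ W := fun s hs => Or.inr (Or.inr (Or.inr hs))
    have rQ : ∀ s ∈ Q, (G.within W).Reachable z s := fun s hs =>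
      reachable_within_mono sQ (hQc z hzQ s hs)
    have rR : ∀ s ∈ R, (G.within W).Reachable z s := fun s hs =>
      reachable_within_mono sR (hRc z hzR s hs)
    have rd0 := (rQ q hQ.right_mem).trans (reachable_within_adj (sQ hQ.right_mem) md0 hqd0)
    have r0 := rd0.trans (reachable_within_adj md0 m0 hd0y0)
    have r1 := r0.trans (reachable_within_adj m0 m1 hy01)
    have r2 := r1.trans (reachable_within_adj m1 m2 hy12)
    have ry : (G.within W).Reachable z y := by
      rcases hyX with e | e
      · exact r2.trans (reachable_within_adj m2 hyW e)
      · exact (rR d hR.right_mem).trans (reachable_within_adj (sR hR.right_mem) hyW e)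
    have key : ∀ s ∈ W, (G.within W).Reachable z s := by
      rintro s ((rfl | rfl | rfl | rfl | rfl | hs) | (rfl | rfl | hs))
      exacts [ry, r2, r1, r0, rd0, rQ s hs, ry, r2, rR s hs]
    exact fun a ha b hb => (key a ha).symm.trans (key b hb)
  refine ⟨W, y, E3, hWS, hWc, hyW, hyz, fun u hu => hKD (hE0K (hE2E0 (hE3E2 hu))), hE3c, hE3big,
    ⟨x3, hx3, hyx3⟩, hyE3, hWE3, ?_⟩
  rcases hyX with hy2y | hdy
  · -- the paths are `z … d y2 y` and `z … q d0 y0 y1 y2 y`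
    have hdy : ¬ G.Adj d y := fun e => hG.not_triangle hdy2 hy2y e
    have A1 : G.IndPath (insert y2 R) z y2 (k + 2) := hR.snoc hdy2 (hR2 y2 ly2)
    have A2 : G.IndPath (insert y (insert y2 R)) z y (k + 3) := by
      refine A1.snoc hy2y ?_
      rintro s (rfl | hs) hne
      · exact (hne rfl).elim
      · by_cases hsd : s = d
        · subst hsd; exact ⟨ne_d y ly, hdy⟩
        · exact hR2 y ly s hs hsd
    have B : G.IndPath (insert y (insert y2 (insert y1 (insert y0 (insert d0 Q))))) z y
        (k + 5) := by
      refine P3.snoc hy2y ?_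
      rintro s (rfl | rfl | rfl | rfl | hs) hne
      · exact (hne rfl).elim
      · exact ⟨ny1y, hy1y⟩
      · exact ⟨ny0y, hy0y⟩
      · exact ⟨ne_d0 y ly, hd0y⟩
      · exact hQ2 y ly s hs
    exact ⟨k + 3, k + 5, A2.mono Set.subset_union_right, B.mono Set.subset_union_left, by omega⟩
  · -- one path is `z … d y`; the other reaches `d` from `q d0`, `q d0 y0` or `q d0 y0 y1 y2`,
    -- whichever of these first sees `d`
    have hdy' : G.Adj d y := hdy
    have hy2y : ¬ G.Adj y2 y := fun e => hG.not_triangle hdy2 e hdy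
    have sub : ∀ T : Set V, T ⊆ insert y0 (insert y1 (insert y2 (insert d0 Q))) →
        insert y (insert d T) ⊆ W := by
      rintro T hT s (rfl | rfl | hs)
      · exact hyW
      · exact Or.inr (Or.inr (Or.inr hR.right_mem))
      · rcases hT hs with rfl | rfl | rfl | rfl | hs
        · exact Or.inl (Or.inr (Or.inr (Or.inr (Or.inl rfl))))
        · exact Or.inl (Or.inr (Or.inr (Or.inl rfl)))
        · exact Or.inr (Or.inr (Or.inl rfl))
        · exact Or.inl (Or.inr (Or.inr (Or.inr (Or.inr (Or.inl rfl)))))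
        · exact Or.inl (Or.inr (Or.inr (Or.inr (Or.inr (Or.inr hs)))))
    have A : G.IndPath (insert y R) z y (k + 2) := hR.snoc hdy' (hR2 y ly)
    have A' : G.IndPath W z y (k + 2) := A.mono (by
      rintro s (rfl | hs)
      exacts [hyW, Or.inr (Or.inr (Or.inr hs))])
    have hQd : ∀ p ∈ Q, p ≠ d ∧ ¬ G.Adj p d := by
      intro p hp
      by_cases hpq : p = q
      · subst hpq; exact ⟨lev_ne hq hd (by omega), hqd⟩
      · exact hQ1 d hd p hp hpq
    by_cases c1 : G.Adj d0 d
    · have B1 : G.IndPath (insert d (insert d0 Q)) z d (k + 2) := by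
        refine P0.snoc c1 ?_
        rintro s (rfl | hs) hne
        · exact (hne rfl).elim
        · exact hQd s hs
      have B2 : G.IndPath (insert y (insert d (insert d0 Q))) z y (k + 3) := by
        refine B1.snoc hdy' ?_
        rintro s (rfl | rfl | hs) hne
        · exact (hne rfl).elim
        · exact ⟨ne_d0 y ly, hd0y⟩
        · exact hQ2 y ly s hs
      exact ⟨k + 2, k + 3, A', B2.mono (sub _ (by
        rintro s (rfl | hs)
        exacts [Or.inr (Or.inr (Or.inr (Or.inl rfl))), Or.inr (Or.inr (Or.inr (Or.inr hs)))])),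
        by omega⟩
    by_cases c2 : G.Adj y0 d
    · have B1 : G.IndPath (insert d (insert y0 (insert d0 Q))) z d (k + 3) := by
        refine P1.snoc c2 ?_
        rintro s (rfl | rfl | hs) hne
        · exact (hne rfl).elim
        · exact ⟨hd0d, c1⟩
        · exact hQd s hs
      have B2 : G.IndPath (insert y (insert d (insert y0 (insert d0 Q)))) z y (k + 4) := by
        refine B1.snoc hdy' ?_
        rintro s (rfl | rfl | rfl | hs) hne
        · exact (hne rfl).elim
        · exact ⟨ny0y, hy0y⟩
        · exact ⟨ne_d0 y ly, hd0y⟩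
        · exact hQ2 y ly s hs
      exact ⟨k + 2, k + 4, A', B2.mono (sub _ (by
        rintro s (rfl | rfl | hs)
        exacts [Or.inl rfl, Or.inr (Or.inr (Or.inr (Or.inl rfl))),
          Or.inr (Or.inr (Or.inr (Or.inr hs)))])), by omega⟩
    · have B1 : G.IndPath (insert d (insert y2 (insert y1 (insert y0 (insert d0 Q))))) z d
          (k + 5) := by
        refine P3.snoc hdy2.symm ?_
        rintro s (rfl | rfl | rfl | rfl | hs) hne
        · exact (hne rfl).elim
        · exact ⟨(ne_d _ ly1).symm, fun e => hdy1 e.symm⟩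
        · exact ⟨(ne_d _ ly0).symm, c2⟩
        · exact ⟨hd0d, c1⟩
        · exact hQd s hs
      have B2 : G.IndPath (insert y (insert d (insert y2 (insert y1 (insert y0 (insert d0 Q))))))
          z y (k + 6) := by
        refine B1.snoc hdy' ?_
        rintro s (rfl | rfl | rfl | rfl | rfl | hs) hne
        · exact (hne rfl).elim
        · exact ⟨ny2y, hy2y⟩
        · exact ⟨ny1y, hy1y⟩
        · exact ⟨ny0y, hy0y⟩
        · exact ⟨ne_d0 y ly, hd0y⟩
        · exact hQ2 y ly s hs
      exact ⟨k + 2, k + 6, A', B2.mono (sub _ (by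
        rintro s (rfl | rfl | rfl | rfl | hs)
        exacts [Or.inr (Or.inr (Or.inl rfl)), Or.inr (Or.inl rfl), Or.inl rfl,
          Or.inr (Or.inr (Or.inr (Or.inl rfl))), Or.inr (Or.inr (Or.inr (Or.inr hs)))])), by omega⟩

/-- Two gadgets in series: all residues modulo three occur as lengths of induced paths. -/
lemma IsTrinity.exists_fullGadget (hG : G.IsTrinity) {τ : ℕ} (hτ : ∀ v, G.ColOn (G.ballTwo v) τ)
    {D : Set V} {z x₀ : V} {N : ℕ} (hD : G.ConnOn D) (hz : z ∉ D) (hx₀ : x₀ ∈ D)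
    (hzx : G.Adj z x₀) (hbig : ¬ G.ColOn D (2 * (2 * (N + τ + 5) + τ + 5))) :
    ∃ (W : Set V) (y : V) (E : Set V), W ⊆ insert z D ∧ G.ConnOn W ∧ y ∈ W ∧ y ≠ z ∧ E ⊆ D ∧
      G.ConnOn E ∧ ¬ G.ColOn E N ∧ (∃ x ∈ E, G.Adj y x) ∧ y ∉ E ∧
      G.Anticomplete (W \ {y}) E ∧ ∀ r, ∃ n, G.IndPath W z y n ∧ n % 3 = r % 3 := by
  obtain ⟨W₁, y₁, E₁, hW₁, hc₁, hy₁, hyz₁, hE₁, hEc₁, hEb₁, ⟨x₁, hx₁, hyx₁⟩, hyE₁, ha₁, n₁, m₁,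
    pn₁, pm₁, hnm₁⟩ := hG.exists_gadget hτ hD hz hx₀ hzx hbig
  obtain ⟨W₂, y₂, E₂, hW₂, hc₂, hy₂, hyz₂, hE₂, hEc₂, hEb₂, hx₂, hyE₂, ha₂, n₂, m₂,
    pn₂, pm₂, hnm₂⟩ := hG.exists_gadget hτ hEc₁ hyE₁ hx₁ hyx₁ hEb₁
  have hy₂E : y₂ ∈ E₁ := (hW₂ hy₂).resolve_left hyz₂
  have hcat : ∀ s ∈ W₁, ∀ t ∈ W₂, s ≠ y₁ → t ≠ y₁ → s ≠ t ∧ ¬ G.Adj s t :=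
    fun s hs t ht hsy hty => ha₁ s ⟨hs, hsy⟩ t ((hW₂ ht).resolve_left hty)
  refine ⟨W₁ ∪ W₂, y₂, E₂, ?_, hc₁.union hc₂ hy₁ pn₂.left_mem, Or.inr hy₂, ?_, hE₂.trans hE₁, hEc₂,
    hEb₂, hx₂, hyE₂, ?_, ?_⟩
  · refine Set.union_subset hW₁ (hW₂.trans (Set.insert_subset (hW₁ hy₁) ?_))
    exact hE₁.trans (Set.subset_insert _ _)
  · rintro rfl; exact hz (hE₁ hy₂E)
  · rintro s ⟨hs | hs, hsy⟩
    · by_cases h : s = y₁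
      · subst h; exact ha₂ s ⟨pn₂.left_mem, hsy⟩
      · exact fun t ht => ha₁ s ⟨hs, h⟩ t (hE₂ ht)
    · exact ha₂ s ⟨hs, hsy⟩
  · intro r
    have h1 := pn₁.concat pn₂ hcat
    have h2 := pn₁.concat pm₂ hcat
    have h3 := pm₁.concat pn₂ hcat
    have h4 := pm₁.concat pm₂ hcat
    by_contra hcon
    push Not at hcon
    have := hcon _ h1; have := hcon _ h2; have := hcon _ h3; have := hcon _ h4
    omega

/-! ### Hubs and rows -/

/-- `B` is a set of hubs between a connected set `U` and a set `L` without edges to `U`: every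
hub is attached to `U`, and every vertex of `L` is attached to a hub. -/
structure IsHubSet (G : SimpleGraph V) (B U L : Set V) : Prop where
  connOn : G.ConnOn U
  anticomplete : G.Anticomplete U L
  notMem_left : ∀ h ∈ B, h ∉ U
  notMem_right : ∀ h ∈ B, h ∉ L
  exists_adj : ∀ h ∈ B, ∃ x ∈ U, G.Adj h x
  exists_hub : ∀ x ∈ L, ∃ h ∈ B, G.Adj h x

/-- The vertex `h` has a neighbour in `S`. -/
def Touches (G : SimpleGraph V) (h : V) (S : Set V) : Prop := ∃ x ∈ S, G.Adj h x

lemma Touches.mono {h : V} {S T : Set V} (ht : G.Touches h S) (hST : S ⊆ T) : G.Touches h T := by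
  obtain ⟨x, hx, e⟩ := ht
  exact ⟨x, hST hx, e⟩

/-- Vertices attached to a connected set are linked through it. -/
lemma ConnOn.exists_indPath {S : Set V} (hS : G.ConnOn S) {h k : V} (hh : G.Touches h S)
    (hk : G.Touches k S) : ∃ n, G.IndPath (insert h (insert k S)) h k n := by
  obtain ⟨x, hx, ex⟩ := hh
  obtain ⟨y, hy, ey⟩ := hk
  have hS' : S ⊆ insert h (insert k S) :=
    (Set.subset_insert _ _).trans (Set.subset_insert _ _)
  refine exists_indPath_of_reachable (by simp) ?_
  exact (reachable_within_adj (by simp) (hS' hx) ex).trans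
    ((reachable_within_mono hS' (hS x hx y hy)).trans
      (reachable_within_adj (hS' hy) (by simp) ey.symm))

/-- The chromatic number that guarantees a row and a remaining set that is not `M`-colourable. -/
def rowBound (τ M : ℕ) : ℕ := 2 * (2 * (M + τ + 1 + τ + 5) + τ + 5) + 1

/-- A full gadget starting at a neighbour `z` of a hub `p` is a row: a hub `k` that touches the
remaining set but not the gadget would be linked to `p` through the gadget by induced paths of all
residues modulo three, one of which closes to a forbidden hole with a path through `U`. -/
lemma IsTrinity.exists_row (hG : G.IsTrinity) {τ : ℕ} (hτ : ∀ v, G.ColOn (G.ballTwo v) τ)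
    {B U L E : Set V} (hB : G.IsHubSet B U L) (hE : E ⊆ L) {N : ℕ}
    (hbig : ¬ G.ColOn E (rowBound τ N)) :
    ∃ W E', W ⊆ E ∧ E' ⊆ E ∧ G.ConnOn W ∧ ¬ G.ColOn E' N ∧ G.Anticomplete W E' ∧
      ∀ k ∈ B, G.Touches k E' → G.Touches k W := by
  obtain ⟨D₀, hD₀, hD₀c, -, ⟨x, hx⟩, hD₀b⟩ := exists_big_component hbig
  obtain ⟨p, hp, hpx⟩ := hB.exists_hub x (hE (hD₀ hx))
  obtain ⟨D, hDD₀, hDc, hDb, hDp, z, hz, hpz, x₁, hx₁, hzx₁⟩ :=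
    hG.exists_cut_neighbors hD₀c hx hpx hD₀b
  have hzD : z ∉ D := fun h => hDp z h hpz
  obtain ⟨W, y, E₃, hW, hWc, hyW, hyz, hE₃, hE₃c, hE₃b, hyE₃', hyE₃, ha, hpath⟩ :=
    hG.exists_fullGadget hτ hDc hzD hx₁ hzx₁ hDb
  have hWE : W ⊆ E := hW.trans (Set.insert_subset (hD₀ hz) (hDD₀.trans hD₀))
  have hE₃E : E₃ ⊆ E := hE₃.trans (hDD₀.trans hD₀)
  refine ⟨W, E₃ \ (G.ballTwo p ∪ {x | G.Adj y x}), hWE,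
    Set.sdiff_subset.trans hE₃E, hWc, ?_, ?_, ?_⟩
  · intro h
    refine hE₃b ((h.union ((hτ p).union (hG.colOn_neighbors y))).mono ?_ (by omega))
    intro u hu
    by_cases h : u ∈ G.ballTwo p ∪ {x | G.Adj y x}
    exacts [Or.inr h, Or.inl ⟨hu, h⟩]
  · rintro s hs t ⟨ht, ht'⟩
    by_cases hsy : s = y
    · subst hsy
      refine ⟨?_, fun e => ht' (Or.inr e)⟩
      rintro rfl; exact hyE₃ ht
    · exact ha s ⟨hs, hsy⟩ t ht
  · rintro k hk ⟨x', ⟨hx', hx''⟩, hkx'⟩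
    by_contra hkW
    have hkW' : ∀ w ∈ W, ¬ G.Adj k w := fun w hw e => hkW ⟨w, hw, e⟩
    have hpk : ¬ G.Adj p k := fun e => hx'' (Or.inl ⟨k, e, hkx'⟩)
    have hpk' : p ≠ k := by rintro rfl; exact hDp x' (hE₃ hx') hkx'
    have BE : ∀ h ∈ B, ∀ u ∈ E, h ≠ u := by
      rintro h hh u hu rfl; exact hB.notMem_right h hh (hE hu)
    obtain ⟨l, hl⟩ := hE₃c.exists_indPath hyE₃' ⟨x', hx', hkx'⟩
    obtain ⟨m, hm⟩ := hB.connOn.exists_indPath (hB.exists_adj p hp) (hB.exists_adj k hk)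
    obtain ⟨n, hn, hn3⟩ := hpath (2 + 2 * (l + m))
    have q1 := hn.concat hl (by
      rintro s hs t (rfl | rfl | ht) hsy hty
      · exact (hty rfl).elim
      · exact ⟨(BE _ hk s (hWE hs)).symm, fun e => hkW' s hs e.symm⟩
      · exact ha s ⟨hs, hsy⟩ t ht)
    have q2 := (q1.symm.snoc hpz.symm (by
      rintro s (hs | rfl | rfl | hs) hsz
      · exact ⟨(BE p hp s (hWE hs)).symm,
          fun e => hDp s ((hW hs).resolve_left hsz) e.symm⟩
      · exact ⟨(BE p hp _ (hWE hyW)).symm,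
          fun e => hDp _ ((hW hyW).resolve_left hyz) e.symm⟩
      · exact ⟨hpk'.symm, fun e => hpk e.symm⟩
      · exact ⟨(BE p hp s (hE₃E hs)).symm, fun e => hDp s (hE₃ hs) e.symm⟩)).symm
    refine hG.not_dvd_of_paths q2 hm (q2.two_le hpk' hpk) (hm.two_le hpk' hpk) ?_ (by omega)
    have aux : ∀ s ∈ E, ∀ t ∈ insert p (insert k U), t ≠ p → t ≠ k → s ≠ t ∧ ¬ G.Adj s t := by
      rintro s hs t (rfl | rfl | ht) h1 h2
      exacts [(h1 rfl).elim, (h2 rfl).elim, hB.anticomplete.symm s (hE hs) t ht]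
    rintro s hs t ht hsp hsk htp htk
    refine aux s ?_ t ht htp htk
    rcases hs with rfl | hs | rfl | rfl | hs
    exacts [(hsp rfl).elim, hWE hs, hWE hyW, (hsk rfl).elim, hE₃E hs]

/-- Any number of pairwise anticomplete connected rows, all touched by every hub that touches the
remaining set `E'` of large chromatic number. -/
lemma IsTrinity.exists_rows (hG : G.IsTrinity) {τ : ℕ} (hτ : ∀ v, G.ColOn (G.ballTwo v) τ)
    {B U L : Set V} (hB : G.IsHubSet B U L) (n N : ℕ) :
    ∀ E ⊆ L, ¬ G.ColOn E ((rowBound τ)^[n] N) →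
    ∃ (W : Fin n → Set V) (E' : Set V), E' ⊆ E ∧ ¬ G.ColOn E' N ∧
      (∀ i, W i ⊆ E ∧ G.ConnOn (W i) ∧ G.Anticomplete (W i) E' ∧
        ∀ k ∈ B, G.Touches k E' → G.Touches k (W i)) ∧
      ∀ i j, i ≠ j → G.Anticomplete (W i) (W j) := by
  induction n with
  | zero => exact fun E hE h => ⟨Fin.elim0, E, subset_rfl, h, fun i => i.elim0, fun i => i.elim0⟩
  | succ n ih =>
    intro E hE h
    rw [Function.iterate_succ_apply'] at h
    obtain ⟨W₀, E₁, hW₀, hE₁, hc, hb, ha, ht⟩ := hG.exists_row hτ hB hE h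
    obtain ⟨W, E', hE', hb', hW, hWW⟩ := ih E₁ (hE₁.trans hE) hb
    refine ⟨Fin.cons W₀ W, E', hE'.trans hE₁, hb', ?_, ?_⟩
    · refine Fin.cases ?_ fun i => ?_
      · exact ⟨hW₀, hc, ha.mono subset_rfl hE', fun k hk hkE => ht k hk (hkE.mono hE')⟩
      · obtain ⟨h1, h2, h3, h4⟩ := hW i
        exact ⟨h1.trans hE₁, h2, h3, h4⟩
    · refine Fin.cases (Fin.cases ?_ fun j _ => ?_) fun i => Fin.cases (fun _ => ?_) fun j hij => ?_
      · simp
      · exact ha.mono subset_rfl (hW j).1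
      · exact (ha.mono subset_rfl (hW i).1).symm
      · exact hWW i j (by rintro rfl; exact hij rfl)

/-! ### Many hubs ported to a common connected set -/

/-- The hubs `f s` have no neighbours in the connected set `Z ⊆ E`, but each has a neighbour
`p s ∈ E` (its port) that is attached to `Z`. -/
structure IsPorted (G : SimpleGraph V) (B E Z : Set V) {n : ℕ} (f p : Fin n → V) : Prop where
  subset : Z ⊆ E
  connOn : G.ConnOn Z
  mem_hub : ∀ s, f s ∈ B
  not_touches : ∀ s, ¬ G.Touches (f s) Z
  port_mem : ∀ s, p s ∈ E
  adj : ∀ s, G.Adj (f s) (p s)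
  touches : ∀ s, G.Touches (p s) Z

/-- If hubs can be picked one after the other, each in the relation `ok` to the previous ones, as
long as the part of `E` under consideration is not covered by the sets `X f` of the earlier hubs,
then `E` has bounded chromatic number unless there are `n` ported hubs.

The colouring is built recursively on connected subsets `Z` of `E`. A hub `h` picked for `Z`
occupies a free slot `s₀`; its neighbours in `Z` get the colour `s₀`, and in the components that
remain, the neighbours of those vertices must avoid the colour `s₀`. A slot is freed in the
components to which its hub is no longer ported. If all `n` slots are occupied, then `n` hubs are
ported to `Z`. -/
lemma IsTrinity.colOn_of_not_ported [Finite V] (hG : G.IsTrinity) {B E : Set V} {n K : ℕ}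
    (ok : V → V → Prop) (hok : ∀ f h, ok f h → ok h f)
    (good : V → Set V → Prop) (hgood : ∀ f Z Z', good f Z → Z' ⊆ Z → good f Z')
    (X : V → Set V) (hX : ∀ f, G.ColOn (X f) K)
    (pick : ∀ Z ⊆ E, ∀ F : Finset V, (∀ f ∈ F, f ∈ B ∧ good f Z) → (∃ x ∈ Z, ∀ f ∈ F, x ∉ X f) →
      ∃ h ∈ B, G.Touches h Z ∧ good h Z ∧ ∀ f ∈ F, ok f h)
    (hno : ∀ Z (f p : Fin n → V), (∀ s t, s ≠ t → ok (f s) (f t)) → ¬ G.IsPorted B E Z f p) :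
    G.ColOn E (n + n * K) := by
  classical
  have main : ∀ (m : ℕ) (Z : Set V), Z.ncard = m → Z ⊆ E → G.ConnOn Z →
      ∀ (A : Finset (Fin n)) (f : Fin n → V) (P : Fin n → Set V),
      (∀ s ∈ A, f s ∈ B ∧ good (f s) Z ∧ ¬ G.Touches (f s) Z ∧
        (∀ p ∈ P s, p ∈ E ∧ G.Adj (f s) p) ∧ ∃ p ∈ P s, G.Touches p Z) →
      (∀ s ∈ A, ∀ t ∈ A, s ≠ t → ok (f s) (f t)) →
      ∃ c : V → ℕ, (∀ x ∈ Z, c x < n + n * K ∧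
        ∀ s ∈ A, (∃ p ∈ P s, G.Adj p x) → c x ≠ s) ∧
        ∀ x ∈ Z, ∀ y ∈ Z, G.Adj x y → c x ≠ c y := by
    intro m
    induction m using Nat.strong_induction_on with
    | _ m ih =>
    intro Z hZm hZE hZc A f P hA hAok
    by_cases hfull : ∃ s₀, s₀ ∉ A
    swap
    · push Not at hfull
      choose h1 h2 h3 h4 p h5 h6 using fun s => hA s (hfull s)
      exact (hno Z f p (fun s t => hAok s (hfull s) t (hfull t))
        ⟨hZE, hZc, h1, h3, fun s => (h4 s _ (h5 s)).1, fun s => (h4 s _ (h5 s)).2, h6⟩).elim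
    obtain ⟨s₀, hs₀⟩ := hfull
    by_cases hcov : ∃ x ∈ Z, ∀ g ∈ A.image f, x ∉ X g
    swap
    · -- the part is covered by the sets `X f`: colours above `n` suffice
      push Not at hcov
      obtain ⟨c, hc1, hc2⟩ := ColOn.biUnion_fin (A.image f) X (fun i _ => hX i)
      have hsub : ∀ x ∈ Z, x ∈ ⋃ g ∈ A.image f, X g := fun x hx => by
        simpa using hcov x hx
      have hle : (A.image f).card * K ≤ n * K :=
        Nat.mul_le_mul_right _ (Finset.card_image_le.trans (by simpa using A.card_le_univ))
      refine ⟨fun x => n + c x, fun x hx => ⟨?_, fun s _ _ => ?_⟩, fun x hx y hy e => ?_⟩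
      · have := hc1 x (hsub x hx); dsimp only; omega
      · have := s.2; dsimp only; omega
      · have := hc2 x (hsub x hx) y (hsub y hy) e; dsimp only; omega
    obtain ⟨h, hhB, hhZ, hhg, hhok⟩ := pick Z hZE (A.image f) (by
      simp only [Finset.mem_image]
      rintro _ ⟨s, hs, rfl⟩
      exact ⟨(hA s hs).1, (hA s hs).2.1⟩) hcov
    have hcomp := exists_coloring_of_components (G := G) (S := Z \ {x | G.Adj h x})
      (Q := fun x k => (k < n + n * K ∧ ∀ s ∈ A, (∃ p ∈ P s, G.Adj p x) → k ≠ s) ∧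
        ((∃ p ∈ Z, G.Adj h p ∧ G.Adj p x) → k ≠ s₀)) (by
      intro C hCZ hCc hCcl hCne
      have hCZ' : C ⊆ Z := hCZ.trans Set.sdiff_subset
      obtain ⟨u, hu, hhu⟩ := hhZ
      have huC : u ∉ C := fun h => (hCZ h).2 hhu
      obtain ⟨x, hx, y, hy, hyC, hxy⟩ := hZc.exists_edge_leaving hCZ' hCne hu huC
      have hhy : G.Adj h y := by
        by_contra hhy; exact hyC (hCcl x hx y ⟨hy, hhy⟩ hxy)
      have hlt : C.ncard < m := by
        rw [← hZm]
        exact Set.ncard_lt_ncard ⟨hCZ', fun h => huC (h hu)⟩ (Set.toFinite _)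
      obtain ⟨c, hc1, hc2⟩ := ih _ hlt C rfl (hCZ'.trans hZE) hCc
        (insert s₀ (A.filter fun s => ∃ p ∈ P s, G.Touches p C))
        (fun s => if s = s₀ then h else f s)
        (fun s => if s = s₀ then {p | p ∈ Z ∧ G.Adj h p} else P s) (by
          intro s hs
          by_cases hss : s = s₀
          · simp only [hss, if_true]
            refine ⟨hhB, hgood _ _ _ hhg hCZ', ?_, fun p hp => ⟨hZE hp.1, hp.2⟩, y, ⟨hy, hhy⟩,
              x, hx, hxy.symm⟩
            rintro ⟨v, hv, e⟩; exact (hCZ hv).2 e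
          · simp only [hss, if_false]
            simp only [Finset.mem_insert, hss, false_or, Finset.mem_filter] at hs
            obtain ⟨h1, h2, h3, h4, -⟩ := hA s hs.1
            exact ⟨h1, hgood _ _ _ h2 hCZ', fun h => h3 (h.mono hCZ'), h4, hs.2⟩) (by
          intro s hs t ht hst
          simp only [Finset.mem_insert, Finset.mem_filter] at hs ht
          by_cases hss : s = s₀
          · have hts : t ≠ s₀ := fun h => hst (hss.trans h.symm)
            simp only [hss, hts, if_true, if_false]
            exact hok _ _ (hhok _ (Finset.mem_image_of_mem f (ht.resolve_left hts).1))
          by_cases hts : t = s₀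
          · simp only [hss, hts, if_true, if_false]
            exact hhok _ (Finset.mem_image_of_mem f (hs.resolve_left hss).1)
          · simp only [hss, hts, if_false]
            exact hAok s (hs.resolve_left hss).1 t (ht.resolve_left hts).1 hst)
      refine ⟨c, fun v hv => ?_, hc2⟩
      obtain ⟨h1, h2⟩ := hc1 v hv
      refine ⟨⟨h1, fun s hs hp => ?_⟩, fun hp => ?_⟩
      · have hss : s ≠ s₀ := by rintro rfl; exact hs₀ hs
        refine h2 s ?_ (by simpa only [hss, if_false] using hp)
        obtain ⟨p, hp, e⟩ := hp
        simp only [Finset.mem_insert, Finset.mem_filter]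
        exact Or.inr ⟨hs, p, hp, v, hv, e⟩
      · refine h2 s₀ (Finset.mem_insert_self _ _) ?_
        obtain ⟨p, hp, e, e'⟩ := hp
        exact ⟨p, by simpa using ⟨hp, e⟩, e'⟩)
    obtain ⟨c, hc1, hc2⟩ := hcomp
    refine ⟨fun x => if G.Adj h x then s₀ else c x, fun x hx => ?_, fun x hx y hy e => ?_⟩
    · by_cases hhx : G.Adj h x
      · simp only [hhx, if_true]
        refine ⟨by have := s₀.2; omega, fun s hs _ heq => hs₀ ?_⟩
        rwa [Fin.ext heq]
      · simp only [hhx, if_false]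
        exact (hc1 x ⟨hx, hhx⟩).1
    · by_cases hhx : G.Adj h x <;> by_cases hhy : G.Adj h y <;>
        simp only [hhx, hhy, if_true, if_false]
      · exact (hG.not_triangle hhx e hhy).elim
      · exact ((hc1 y ⟨hy, hhy⟩).2 ⟨x, hx, hhx, e⟩).symm
      · exact (hc1 x ⟨hx, hhx⟩).2 ⟨y, hy, hhy, e.symm⟩
      · exact hc2 x ⟨hx, hhx⟩ y ⟨hy, hhy⟩ e
  by_contra hcon
  obtain ⟨C, hC, hCc, -, ⟨x, -⟩, hCb⟩ := exists_big_component hcon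
  obtain ⟨c, hc1, hc2⟩ := main _ C rfl hC hCc ∅ (fun _ => x) (fun _ => ∅) (by simp) (by simp)
  exact hCb ⟨c, fun x hx => (hc1 x hx).1, hc2⟩

/-! ### Links between nonadjacent hubs -/

/-- If `k` and `m` have no common neighbour, then a shortest path in `W` from the neighbours of `h`
to those of `k` or `m` is touched by exactly one of `k` and `m`. -/
lemma ConnOn.exists_avoiding {W : Set V} (hW : G.ConnOn W) {h k m : V} (hh : G.Touches h W)
    (hkm : G.Touches k W) (hno : ∀ x, G.Adj k x → ¬ G.Adj m x) :
    ∃ W' ⊆ W, G.ConnOn W' ∧ G.Touches h W' ∧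
      ((G.Touches k W' ∧ ¬ G.Touches m W') ∨ (G.Touches m W' ∧ ¬ G.Touches k W')) := by
  classical
  have hex : ∃ n u v, G.Adj h u ∧ (G.Adj k v ∨ G.Adj m v) ∧ G.IndPath W u v n := by
    obtain ⟨u, hu, eu⟩ := hh
    obtain ⟨v, hv, ev⟩ := hkm
    obtain ⟨n, hn⟩ := exists_indPath_of_reachable hu (hW u hu v hv)
    exact ⟨n, u, v, eu, Or.inl ev, hn⟩
  obtain ⟨u, v, hu, hv, f, f0, fn, fS, fi, fa⟩ := Nat.find_spec hex
  set n := Nat.find hex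
  have hmin : ∀ i < n, ¬ (G.Adj k (f i) ∨ G.Adj m (f i)) := by
    intro i hi hki
    exact Nat.find_min hex hi ⟨u, f i, hu, hki, f, f0, rfl, fun j hj => fS j (by omega),
      fun j hj l hl => fi j (by omega) l (by omega), fun j hj l hl => fa j (by omega) l (by omega)⟩
  have hnot : ∀ x : V, (∀ i < n, ¬ G.Adj x (f i)) → ¬ G.Adj x v →
      ¬ G.Touches x (f '' Set.Iic n) := by
    rintro x h1 h2 ⟨_, ⟨i, hi, rfl⟩, e⟩
    rcases (Set.mem_Iic.1 hi).lt_or_eq with hlt | rfl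
    · exact h1 i hlt e
    · rw [fn] at e; exact h2 e
  have hvm : v ∈ f '' Set.Iic n := ⟨n, Set.mem_Iic.2 le_rfl, fn⟩
  refine ⟨f '' Set.Iic n, by rintro _ ⟨i, hi, rfl⟩; exact fS i hi,
    connOn_image_Iic fun i hi => (fa i hi.le (i + 1) hi).2 (Or.inl rfl),
    ⟨u, ⟨0, by simp, f0⟩, hu⟩, ?_⟩
  rcases hv with hv | hv
  · exact Or.inl ⟨⟨v, hvm, hv⟩, hnot m (fun i hi e => hmin i hi (Or.inr e)) (hno v hv)⟩
  · exact Or.inr ⟨⟨v, hvm, hv⟩, hnot k (fun i hi e => hmin i hi (Or.inl e)) fun e => hno v e hv⟩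

/-- Two induced paths between nonadjacent vertices through anticomplete sets close to a hole. -/
lemma IsTrinity.not_dvd_of_links (hG : G.IsTrinity) {h k : V} (hne : h ≠ k) (hnadj : ¬ G.Adj h k)
    {S T : Set V} (hST : G.Anticomplete S T) {n m : ℕ}
    (hn : G.IndPath (insert h (insert k S)) h k n) (hm : G.IndPath (insert h (insert k T)) h k m) :
    ¬ 3 ∣ n + m := by
  refine hG.not_dvd_of_paths hn hm (hn.two_le hne hnadj) (hm.two_le hne hnadj) ?_
  rintro s (rfl | rfl | hs) t (rfl | rfl | ht) h1 h2 h3 h4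
  all_goals first | exact (h1 rfl).elim | exact (h2 rfl).elim | exact (h3 rfl).elim |
    exact (h4 rfl).elim | exact hST s hs t ht

/-- All induced paths from `h` to `k` through `S` have length `σ` modulo three. -/
def LinkType (G : SimpleGraph V) (S : Set V) (σ : ℕ) (h k : V) : Prop :=
  ∀ n, G.IndPath (insert h (insert k S)) h k n → n % 3 = σ

lemma LinkType.symm {S : Set V} {σ : ℕ} {h k : V} (hl : G.LinkType S σ h k) :
    G.LinkType S σ k h := by
  intro n hn
  rw [Set.insert_comm] at hn
  exact hl n hn.symm

/-- The rows `W i`, with at most one exception, give links of length `σ` modulo three. -/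
def RowType (G : SimpleGraph V) {r : ℕ} (W : Fin r → Set V) (σ : ℕ) (h k : V) : Prop :=
  ∃ i₀, ∀ i ≠ i₀, G.LinkType (W i) σ h k

lemma RowType.symm {r : ℕ} {W : Fin r → Set V} {σ : ℕ} {h k : V} (hl : G.RowType W σ h k) :
    G.RowType W σ k h := by
  obtain ⟨i₀, hi₀⟩ := hl
  exact ⟨i₀, fun i hi => (hi₀ i hi).symm⟩

/-- At most one row has a link of length divisible by three, and among the other rows links of
lengths one and two modulo three cannot both occur. -/
lemma IsTrinity.exists_rowType (hG : G.IsTrinity) {W : Fin 5 → Set V}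
    (hW : ∀ i, G.ConnOn (W i)) (hWW : ∀ i j, i ≠ j → G.Anticomplete (W i) (W j)) {h k : V}
    (hne : h ≠ k) (hnadj : ¬ G.Adj h k) (hh : ∀ i, G.Touches h (W i))
    (hk : ∀ i, G.Touches k (W i)) : G.RowType W 1 h k ∨ G.RowType W 2 h k := by
  have hlink := fun i => (hW i).exists_indPath (hh i) (hk i)
  have hsum : ∀ i j, i ≠ j → ∀ n m, G.IndPath (insert h (insert k (W i))) h k n →
      G.IndPath (insert h (insert k (W j))) h k m → ¬ 3 ∣ n + m :=
    fun i j hij n m hn hm => hG.not_dvd_of_links hne hnadj (hWW i j hij) hn hm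
  have h0 : ∃ i₀, ∀ i ≠ i₀, ∀ n, G.IndPath (insert h (insert k (W i))) h k n → n % 3 ≠ 0 := by
    by_contra hcon
    push Not at hcon
    obtain ⟨i, -, n, hn, hn0⟩ := hcon 0
    obtain ⟨j, hji, m, hm, hm0⟩ := hcon i
    exact hsum i j hji.symm n m hn hm (by omega)
  obtain ⟨i₀, hi₀⟩ := h0
  obtain ⟨i₁, i₂, h1, h2, h12⟩ : ∃ i₁ i₂ : Fin 5, i₁ ≠ i₀ ∧ i₂ ≠ i₀ ∧ i₁ ≠ i₂ := by
    have : ∀ i₀ : Fin 5, ∃ i₁ i₂ : Fin 5, i₁ ≠ i₀ ∧ i₂ ≠ i₀ ∧ i₁ ≠ i₂ := by decide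
    exact this i₀
  obtain ⟨n₁, hn₁⟩ := hlink i₁
  obtain ⟨n₂, hn₂⟩ := hlink i₂
  have e1 := hi₀ i₁ h1 n₁ hn₁
  have e2 := hi₀ i₂ h2 n₂ hn₂
  have e12 := hsum i₁ i₂ h12 n₁ n₂ hn₁ hn₂
  have key : ∀ i ≠ i₀, ∀ n, G.IndPath (insert h (insert k (W i))) h k n → n % 3 = n₁ % 3 := by
    intro i hi n hn
    have e3 := hi₀ i hi n hn
    by_cases hi1 : i = i₁
    · have := hsum i i₂ (hi1 ▸ h12) n n₂ hn hn₂; omega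
    · have := hsum i i₁ hi1 n n₁ hn hn₁; omega
  rcases (by omega : n₁ % 3 = 1 ∨ n₁ % 3 = 2) with e | e
  · exact Or.inl ⟨i₀, fun i hi n hn => (key i hi n hn).trans e⟩
  · exact Or.inr ⟨i₀, fun i hi n hn => (key i hi n hn).trans e⟩

/-- If in two rows all links between three hubs have the same nonzero length `σ` modulo three, and
if the middle hub `b` is linked to `a` in one row and to `c` in the other, avoiding the third hub,
then a link `l` of `a` and `c` that avoids `b` and both rows satisfies `l + σ, l + 2 σ ≢ 0`, hence
`l ≡ 0`. Two such links, through `Z` and `U`, close to a hole of length `0` modulo three. -/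
lemma IsTrinity.false_of_linkType (hG : G.IsTrinity) {a b c : V} {W W' S S' Z U : Set V} {σ : ℕ}
    (hσ : σ = 1 ∨ σ = 2) (hab : a ≠ b) (hbc : b ≠ c) (hac : a ≠ c) (nab : ¬ G.Adj a b)
    (nbc : ¬ G.Adj b c) (nac : ¬ G.Adj a c)
    (hb : b ∉ W ∪ W' ∪ Z ∪ U) (ha : a ∉ W ∪ W' ∪ Z ∪ U) (hc : c ∉ W ∪ W' ∪ Z ∪ U)
    (hWc : G.ConnOn W) (haW : G.Touches a W) (hcW : G.Touches c W) (tW : G.LinkType W σ a c)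
    (tab : G.LinkType W σ a b) (tbc : G.LinkType W' σ b c)
    (hS : S ⊆ W) (hSc : G.ConnOn S) (haS : G.Touches a S) (hbS : G.Touches b S)
    (hcS : ¬ G.Touches c S)
    (hS' : S' ⊆ W') (hSc' : G.ConnOn S') (hbS' : G.Touches b S') (hcS' : G.Touches c S')
    (haS' : ¬ G.Touches a S')
    (hZc : G.ConnOn Z) (haZ : G.Touches a Z) (hcZ : G.Touches c Z) (hbZ : ¬ G.Touches b Z)
    (hUc : G.ConnOn U) (haU : G.Touches a U) (hcU : G.Touches c U) (hbU : ¬ G.Touches b U)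
    (hWW : G.Anticomplete W W') (hWZ : G.Anticomplete W Z) (hWZ' : G.Anticomplete W' Z)
    (hWU : G.Anticomplete W U) (hWU' : G.Anticomplete W' U) (hZU : G.Anticomplete Z U) :
    False := by
  obtain ⟨n₁, p₁⟩ := hSc.exists_indPath haS hbS
  obtain ⟨n₂, p₂⟩ := hSc'.exists_indPath hbS' hcS'
  have e1 := tab _ (p₁.mono (Set.insert_subset_insert (Set.insert_subset_insert hS)))
  have e2 := tbc _ (p₂.mono (Set.insert_subset_insert (Set.insert_subset_insert hS')))
  obtain ⟨n, p⟩ := hWc.exists_indPath haW hcW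
  have e := tW _ p
  simp only [Set.mem_union, not_or] at ha hb hc
  have q := p₁.concat p₂ (by
    rintro s (rfl | rfl | hs) t (rfl | rfl | ht) h1 h2
    · exact (h2 rfl).elim
    · exact ⟨hac, nac⟩
    · refine ⟨?_, fun e => haS' ⟨t, ht, e⟩⟩
      rintro rfl; exact ha.1.1.2 (hS' ht)
    · exact (h1 rfl).elim
    · exact (h1 rfl).elim
    · exact (h1 rfl).elim
    · exact (h2 rfl).elim
    · refine ⟨?_, fun e => hcS ⟨s, hs, e.symm⟩⟩
      rintro rfl; exact hc.1.1.1 (hS hs)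
    · exact hWW s (hS hs) t (hS' ht))
  have key : ∀ T : Set V, b ∉ T → G.ConnOn T → G.Touches a T → G.Touches c T → ¬ G.Touches b T →
      G.Anticomplete W T → G.Anticomplete W' T →
      ∃ l, G.IndPath (insert a (insert c T)) a c l ∧ l % 3 = 0 := by
    intro T hbT hT haT hcT hbT' hWT hWT'
    obtain ⟨l, pl⟩ := hT.exists_indPath haT hcT
    refine ⟨l, pl, ?_⟩
    have f1 := hG.not_dvd_of_links hac nac hWT p pl
    have f2 := hG.not_dvd_of_paths q pl (q.two_le hac nac) (pl.two_le hac nac) (by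
      rintro s hs t (rfl | rfl | ht) h1 h2 h3 h4
      · exact (h3 rfl).elim
      · exact (h4 rfl).elim
      rcases hs with (rfl | rfl | hs) | (rfl | rfl | hs)
      · exact (h1 rfl).elim
      · exact ⟨by rintro rfl; exact hbT ht, fun e => hbT' ⟨t, ht, e⟩⟩
      · exact hWT s (hS hs) t ht
      · exact ⟨by rintro rfl; exact hbT ht, fun e => hbT' ⟨t, ht, e⟩⟩
      · exact (h2 rfl).elim
      · exact hWT' s (hS' hs) t ht)
    omega
  obtain ⟨l, pl, el⟩ := key Z hb.1.2 hZc haZ hcZ hbZ hWZ hWZ'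
  obtain ⟨m, pm, em⟩ := key U hb.2 hUc haU hcU hbU hWU hWU'
  exact hG.not_dvd_of_links hac nac hZU pl pm (by omega)

/-- Three pairwise distinct elements of `S` that are pairwise in the relation `P`. -/
def HasTriangle {α : Type*} (P : α → α → Prop) (S : Finset α) : Prop :=
  ∃ x ∈ S, ∃ y ∈ S, ∃ z ∈ S, x ≠ y ∧ y ≠ z ∧ x ≠ z ∧ P x y ∧ P y z ∧ P x z

lemma HasTriangle.mono {α : Type*} {P : α → α → Prop} {S T : Finset α} (h : HasTriangle P S)
    (hST : S ⊆ T) : HasTriangle P T := by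
  obtain ⟨x, hx, y, hy, z, hz, h⟩ := h
  exact ⟨x, hST hx, y, hST hy, z, hST hz, h⟩

/-- Within the `P`-neighbours of `v` either some pair is in the relation `P`, completing a triangle,
or none is. -/
lemma hasTriangle_or_forall_not {α : Type*} [DecidableEq α] {P : α → α → Prop} {S T : Finset α}
    {v : α} (hv : v ∈ S) (hT : ∀ x ∈ T, x ∈ S ∧ x ≠ v ∧ P v x) :
    HasTriangle P S ∨ ∀ x ∈ T, ∀ y ∈ T, x ≠ y → ¬ P x y := by
  by_contra! hcon
  obtain ⟨h1, x, hx, y, hy, hxy, hP⟩ := hcon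
  exact h1 ⟨v, hv, x, (hT x hx).1, y, (hT y hy).1, (hT x hx).2.1.symm, hxy, (hT y hy).2.1.symm,
    (hT x hx).2.2, hP, (hT y hy).2.2⟩

lemma hasTriangle_of_forall {α : Type*} {P : α → α → Prop} {S : Finset α} (hS : 3 ≤ S.card)
    (h : ∀ x ∈ S, ∀ y ∈ S, x ≠ y → P x y) : HasTriangle P S := by
  obtain ⟨x, y, z, hx, hy, hz, hxy, hxz, hyz⟩ := Finset.two_lt_card_iff.1 hS
  exact ⟨x, hx, y, hy, z, hz, hxy, hyz, hxz, h x hx y hy hxy, h y hy z hz hyz, h x hx z hz hxz⟩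

/-- The Ramsey number `R(3, 3)` is at most `6`. -/
lemma hasTriangle_or_of_six {α : Type*} {P Q : α → α → Prop}
    {S : Finset α} (hS : 6 ≤ S.card) (h : ∀ x ∈ S, ∀ y ∈ S, x ≠ y → P x y ∨ Q x y) :
    HasTriangle P S ∨ HasTriangle Q S := by
  classical
  obtain ⟨v, hv⟩ : S.Nonempty := Finset.card_pos.1 (by omega)
  have hcard := Finset.card_filter_add_card_filter_not (s := S.erase v) (fun x => P v x)
  rw [Finset.card_erase_of_mem hv] at hcard
  rcases (by omega : 3 ≤ ((S.erase v).filter fun x => P v x).card ∨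
    3 ≤ ((S.erase v).filter fun x => ¬ P v x).card) with hc | hc
  · refine (hasTriangle_or_forall_not (P := P) (T := (S.erase v).filter fun x => P v x) hv
      (by simp; tauto)).imp_right fun hn =>
      (hasTriangle_of_forall hc fun x hx y hy hxy => ?_).mono
        ((Finset.filter_subset _ _).trans (Finset.erase_subset _ _))
    refine (h x ?_ y ?_ hxy).resolve_left (hn x hx y hy hxy) <;> simp at hx hy <;> tauto
  · refine ((hasTriangle_or_forall_not (P := Q) (T := (S.erase v).filter fun x => ¬ P v x) hv
      ?_).imp_right fun hn =>
      (hasTriangle_of_forall hc fun x hx y hy hxy => ?_).mono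
        ((Finset.filter_subset _ _).trans (Finset.erase_subset _ _))).symm
    · intro x hx
      simp only [Finset.mem_filter, Finset.mem_erase] at hx
      exact ⟨hx.1.2, hx.1.1, (h v hv x hx.1.2 hx.1.1.symm).resolve_left hx.2⟩
    · refine (h x ?_ y ?_ hxy).resolve_right (hn x hx y hy hxy) <;> simp at hx hy <;> tauto

/-- The Ramsey number `R(3, 3, 3)` is at most `17`. -/
lemma hasTriangle_or_of_seventeen {α : Type*} {P Q R : α → α → Prop}
    {S : Finset α} (hS : 17 ≤ S.card) (h : ∀ x ∈ S, ∀ y ∈ S, x ≠ y → P x y ∨ Q x y ∨ R x y) :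
    HasTriangle P S ∨ HasTriangle Q S ∨ HasTriangle R S := by
  classical
  obtain ⟨v, hv⟩ : S.Nonempty := Finset.card_pos.1 (by omega)
  set A := (S.erase v).filter fun x => P v x with hA
  set A' := (S.erase v).filter fun x => ¬ P v x with hA'
  set C := A'.filter fun x => Q v x with hC
  set D := A'.filter fun x => ¬ Q v x with hD
  have hcard : A.card + A'.card = (S.erase v).card := Finset.card_filter_add_card_filter_not _
  have hcard' : C.card + D.card = A'.card := Finset.card_filter_add_card_filter_not _
  rw [Finset.card_erase_of_mem hv] at hcard
  have hAS : ∀ x ∈ A, x ∈ S ∧ x ≠ v ∧ P v x := by simp [hA]; tauto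
  have hCS : ∀ x ∈ C, x ∈ S ∧ x ≠ v ∧ Q v x := by simp [hC, hA']; tauto
  have hDS : ∀ x ∈ D, x ∈ S ∧ x ≠ v ∧ R v x := by
    intro x hx
    simp only [hD, hA', Finset.mem_filter, Finset.mem_erase] at hx
    have := h v hv x hx.1.1.2 hx.1.1.1.symm
    tauto
  rcases (by omega : 6 ≤ A.card ∨ 6 ≤ C.card ∨ 6 ≤ D.card) with hc | hc | hc
  · refine (hasTriangle_or_forall_not hv hAS).imp_right fun hn => ?_
    exact (hasTriangle_or_of_six (P := Q) (Q := R) hc fun x hx y hy hxy =>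
      (h x (hAS x hx).1 y (hAS y hy).1 hxy).resolve_left (hn x hx y hy hxy)).imp
      (fun ht => ht.mono fun x hx => (hAS x hx).1) fun ht => ht.mono fun x hx => (hAS x hx).1
  · rcases hasTriangle_or_forall_not hv hCS with ht | hn
    · exact Or.inr (Or.inl ht)
    rcases hasTriangle_or_of_six (P := P) (Q := R) hc fun x hx y hy hxy => by
      have := h x (hCS x hx).1 y (hCS y hy).1 hxy
      have := hn x hx y hy hxy
      tauto with ht | ht
    · exact Or.inl (ht.mono fun x hx => (hCS x hx).1)
    · exact Or.inr (Or.inr (ht.mono fun x hx => (hCS x hx).1))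
  · rcases hasTriangle_or_forall_not hv hDS with ht | hn
    · exact Or.inr (Or.inr ht)
    rcases hasTriangle_or_of_six (P := P) (Q := Q) hc fun x hx y hy hxy => by
      have := h x (hDS x hx).1 y (hDS y hy).1 hxy
      have := hn x hx y hy hxy
      tauto with ht | ht
    · exact Or.inl (ht.mono fun x hx => (hDS x hx).1)
    · exact Or.inr (Or.inl (ht.mono fun x hx => (hDS x hx).1))

/-- `f` and `h` are distinct and have no common neighbour. -/
def Far (G : SimpleGraph V) (f h : V) : Prop := f ≠ h ∧ ∀ x, G.Adj f x → ¬ G.Adj h x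

lemma Far.symm {f h : V} (hf : G.Far f h) : G.Far h f :=
  ⟨hf.1.symm, fun x h1 h2 => hf.2 x h2 h1⟩

/-- A system of five rows excludes seventeen ported hubs that are pairwise far. -/
lemma IsTrinity.not_isPorted (hG : G.IsTrinity) {B U L E Z : Set V} (hB : G.IsHubSet B U L)
    (hE : E ⊆ L) {W : Fin 5 → Set V}
    (hW : ∀ i, W i ⊆ L ∧ G.ConnOn (W i) ∧ G.Anticomplete (W i) E ∧
      ∀ k ∈ B, G.Touches k E → G.Touches k (W i))
    (hWW : ∀ i j, i ≠ j → G.Anticomplete (W i) (W j))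
    (havoid : ∀ h ∈ B, ∀ k ∈ B, ∀ m ∈ B, G.Far h m → G.Far k m →
      ∃ U' ⊆ U, G.ConnOn U' ∧ G.Touches h U' ∧ G.Touches k U' ∧ ¬ G.Touches m U')
    {f p : Fin 17 → V} (hfar : ∀ s t, s ≠ t → G.Far (f s) (f t)) : ¬ G.IsPorted B E Z f p := by
  intro hP
  have hfB := hP.mem_hub
  have tW : ∀ s i, G.Touches (f s) (W i) := fun s i =>
    (hW i).2.2.2 _ (hfB s) ⟨p s, hP.port_mem s, hP.adj s⟩
  -- the hub `b` is linked to `a` off `c` in the row `w`, and to `c` off `a` in the row `w'`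
  have core : ∀ σ, (σ = 1 ∨ σ = 2) → ∀ w w', w ≠ w' → ∀ a b c, a ≠ b → b ≠ c → a ≠ c →
      ¬ G.Adj (f a) (f b) → ¬ G.Adj (f b) (f c) → ¬ G.Adj (f a) (f c) →
      G.LinkType (W w) σ (f a) (f c) → G.LinkType (W w) σ (f a) (f b) →
      G.LinkType (W w') σ (f b) (f c) →
      (∃ S ⊆ W w, G.ConnOn S ∧ G.Touches (f a) S ∧ G.Touches (f b) S ∧ ¬ G.Touches (f c) S) →
      (∃ S ⊆ W w', G.ConnOn S ∧ G.Touches (f b) S ∧ G.Touches (f c) S ∧ ¬ G.Touches (f a) S) →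
      False := by
    rintro σ hσ w w' hww a b c hab hbc hac nab nbc nac tac tab tbc ⟨S, hS, hSc, h1, h2, h3⟩
      ⟨S', hS', hSc', h1', h2', h3'⟩
    obtain ⟨U', hU', hUc, haU, hcU, hbU⟩ := havoid _ (hfB a) _ (hfB c) _ (hfB b) (hfar a b hab)
      (hfar c b hbc.symm)
    have hZE : insert (p a) (insert (p c) Z) ⊆ E :=
      Set.insert_subset (hP.port_mem a) (Set.insert_subset (hP.port_mem c) hP.subset)
    have hZc : G.ConnOn (insert (p a) (insert (p c) Z)) := by
      obtain ⟨x, hx, e⟩ := hP.touches a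
      obtain ⟨y, hy, e'⟩ := hP.touches c
      exact (hP.connOn.insert_of_adj hy e').insert_of_adj (Or.inr hx) e
    have hbZ : ¬ G.Touches (f b) (insert (p a) (insert (p c) Z)) := by
      rintro ⟨x, rfl | rfl | hx, e⟩
      · exact (hfar a b hab).2 _ (hP.adj a) e
      · exact (hfar c b hbc.symm).2 _ (hP.adj c) e
      · exact hP.not_touches b ⟨x, hx, e⟩
    have hnm : ∀ s, f s ∉ W w ∪ W w' ∪ insert (p a) (insert (p c) Z) ∪ U' := by
      rintro s (((h | h) | h) | h)
      · exact hB.notMem_right _ (hfB s) ((hW w).1 h)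
      · exact hB.notMem_right _ (hfB s) ((hW w').1 h)
      · exact hB.notMem_right _ (hfB s) (hE (hZE h))
      · exact hB.notMem_left _ (hfB s) (hU' h)
    have hUL := hB.anticomplete.symm
    exact hG.false_of_linkType hσ (hfar a b hab).1 (hfar b c hbc).1 (hfar a c hac).1 nab nbc nac
      (hnm b) (hnm a) (hnm c) (hW w).2.1 (tW a w) (tW c w) tac tab tbc hS hSc h1 h2 h3 hS' hSc'
      h1' h2' h3' hZc ⟨p a, Or.inl rfl, hP.adj a⟩ ⟨p c, Or.inr (Or.inl rfl), hP.adj c⟩ hbZ hUc haU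
      hcU hbU (hWW w w' hww) ((hW w).2.2.1.mono subset_rfl hZE)
      ((hW w').2.2.1.mono subset_rfl hZE) (hUL.mono (hW w).1 hU') (hUL.mono (hW w').1 hU')
      (hUL.mono (hZE.trans hE) hU')
  have avail : ∀ w a b c, b ≠ c →
      (∃ S ⊆ W w, G.ConnOn S ∧ G.Touches (f a) S ∧ G.Touches (f b) S ∧ ¬ G.Touches (f c) S) ∨
      (∃ S ⊆ W w, G.ConnOn S ∧ G.Touches (f a) S ∧ G.Touches (f c) S ∧ ¬ G.Touches (f b) S) := by
    intro w a b c hbc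
    obtain ⟨S, hS, h1, h2, h3 | h3⟩ := (hW w).2.1.exists_avoiding (tW a w) (tW b w)
      (hfar b c hbc).2
    · exact Or.inl ⟨S, hS, h1, h2, h3⟩
    · exact Or.inr ⟨S, hS, h1, h2, h3⟩
  have swap : ∀ {w a b c},
      (∃ S ⊆ W w, G.ConnOn S ∧ G.Touches (f a) S ∧ G.Touches (f b) S ∧ ¬ G.Touches (f c) S) →
      (∃ S ⊆ W w, G.ConnOn S ∧ G.Touches (f b) S ∧ G.Touches (f a) S ∧ ¬ G.Touches (f c) S) := by
    rintro w a b c ⟨S, h1, h2, h3, h4, h5⟩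
    exact ⟨S, h1, h2, h4, h3, h5⟩
  -- no three nonadjacent hubs are of the same type
  have fin : ∀ σ, (σ = 1 ∨ σ = 2) → ¬ HasTriangle
      (fun s t => ¬ G.Adj (f s) (f t) ∧ G.RowType W σ (f s) (f t)) Finset.univ := by
    rintro σ hσ ⟨a, -, b, -, c, -, hab, hbc, hac, ⟨nab, i, hi⟩, ⟨nbc, j, hj⟩, ⟨nac, k, hk⟩⟩
    have hrows : ∀ i j k : Fin 5, ∃ w w' : Fin 5, w ≠ w' ∧ (w ≠ i ∧ w ≠ j ∧ w ≠ k) ∧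
        w' ≠ i ∧ w' ≠ j ∧ w' ≠ k := by decide
    obtain ⟨w, w', hww, ⟨h1, h2, h3⟩, h1', h2', h3'⟩ := hrows i j k
    have nba : ¬ G.Adj (f b) (f a) := fun e => nab e.symm
    have ncb : ¬ G.Adj (f c) (f b) := fun e => nbc e.symm
    have nca : ¬ G.Adj (f c) (f a) := fun e => nac e.symm
    rcases avail w a b c hbc with p1 | p1
    · rcases avail w' c b a hab.symm with p2 | p2
      · exact core σ hσ w w' hww a b c hab hbc hac nab nbc nac (hk w h3) (hi w h1) (hj w' h2') p1
          (swap p2)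
      · exact core σ hσ w w' hww b a c hab.symm hac hbc nba nac nbc (hj w h2) (hi w h1).symm
          (hk w' h3') (swap p1) (swap p2)
    · rcases avail w' b a c hac with p2 | p2
      · exact core σ hσ w w' hww c a b hac.symm hab hbc.symm nca nab ncb (hj w h2).symm
          (hk w h3).symm (hi w' h1') (swap p1) (swap p2)
      · exact core σ hσ w w' hww a c b hac hbc.symm hab nac ncb nab (hi w h1) (hk w h3)
          (hj w' h2').symm p1 (swap p2)
  rcases hasTriangle_or_of_seventeen (P := fun s t => G.Adj (f s) (f t))
    (Q := fun s t => ¬ G.Adj (f s) (f t) ∧ G.RowType W 1 (f s) (f t))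
    (R := fun s t => ¬ G.Adj (f s) (f t) ∧ G.RowType W 2 (f s) (f t))
    (S := Finset.univ) (by simp) (fun s _ t _ hst => by
      by_cases e : G.Adj (f s) (f t)
      · exact Or.inl e
      · rcases hG.exists_rowType (fun i => (hW i).2.1) hWW (hfar s t hst).1 e (tW s) (tW t)
          with h | h
        exacts [Or.inr (Or.inl ⟨e, h⟩), Or.inr (Or.inr ⟨e, h⟩)]) with h | h | h
  · obtain ⟨a, -, b, -, c, -, -, -, -, h1, h2, h3⟩ := h
    exact hG.not_triangle h1 h2 h3
  · exact fin 1 (Or.inl rfl) h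
  · exact fin 2 (Or.inr rfl) h

/-! ### The levels of the whole graph -/

lemma level_univ_one {z q : V} (e : G.Adj z q) : q ∈ G.level Set.univ z 1 := by
  have e' : (G.within Set.univ).Adj z q := ⟨e, trivial, trivial⟩
  exact ⟨e'.reachable, dist_eq_one_iff_adj.2 e'⟩

lemma adj_of_mem_level_one {S : Set V} {z q : V} (h : q ∈ G.level S z 1) : G.Adj z q := by
  obtain ⟨d, hd, e⟩ := exists_parent h
  rw [level_zero] at hd
  rwa [hd] at e

/-- The vertices at distance at most `j` from `z`. -/
def levelsLE (G : SimpleGraph V) (z : V) (j : ℕ) : Set V :=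
  {x | ∃ i ≤ j, x ∈ G.level Set.univ z i}

lemma connOn_levelsLE (z : V) (j : ℕ) : G.ConnOn (G.levelsLE z j) := by
  have key : ∀ x ∈ G.levelsLE z j, (G.within (G.levelsLE z j)).Reachable z x := by
    rintro x ⟨i, hi, hx⟩
    obtain ⟨P, hP, -, hlev⟩ := exists_geodesic (Set.mem_univ z) hx
    obtain ⟨Q, hQP, hQc, hQ⟩ := hP.exists_connOn
    refine reachable_within_mono ?_ (hQc z hQ.left_mem x hQ.right_mem)
    intro p hp
    rcases hlev p (hQP hp) with rfl | ⟨l, hl, hpl⟩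
    exacts [⟨i, hi, hx⟩, ⟨l, by omega, hpl⟩]
  exact fun a ha b hb => (key a ha).symm.trans (key b hb)

lemma level_ne_not_adj {z x y : V} {i j : ℕ} (hx : x ∈ G.level Set.univ z i)
    (hy : y ∈ G.level Set.univ z j) (hij : i + 2 ≤ j) : x ≠ y ∧ ¬ G.Adj x y := by
  refine ⟨?_, fun e => ?_⟩
  · rintro rfl; have := level_inj hx hy; omega
  · have := level_adj_le (Set.mem_univ z) hx hy e; omega

lemma isHubSet_level (z : V) (k : ℕ) :
    G.IsHubSet (G.level Set.univ z (k + 2)) (G.levelsLE z (k + 1))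
      (G.level Set.univ z (k + 3)) where
  connOn := connOn_levelsLE z _
  anticomplete := by
    rintro s ⟨i, hi, hs⟩ t ht
    exact level_ne_not_adj hs ht (by omega)
  notMem_left := by
    rintro h hh ⟨i, hi, hh'⟩
    have := level_inj hh hh'; omega
  notMem_right := by
    intro h hh hh'
    have := level_inj hh hh'; omega
  exists_adj := by
    intro h hh
    obtain ⟨d, hd, e⟩ := exists_parent hh
    exact ⟨d, ⟨k + 1, le_rfl, hd⟩, e.symm⟩
  exists_hub := fun x hx => exists_parent hx

/-- The parents of `h` and `k` are not adjacent to `m`, and neither are the lower levels. -/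
lemma exists_avoiding_levels {z : V} {i : ℕ} {h k m : V} (hh : h ∈ G.level Set.univ z (i + 2))
    (hk : k ∈ G.level Set.univ z (i + 2)) (hm : m ∈ G.level Set.univ z (i + 2))
    (hhm : G.Far h m) (hkm : G.Far k m) :
    ∃ U' ⊆ G.levelsLE z (i + 1), G.ConnOn U' ∧ G.Touches h U' ∧ G.Touches k U' ∧
      ¬ G.Touches m U' := by
  obtain ⟨a, ha, eah⟩ := exists_parent hh
  obtain ⟨b, hb, ebk⟩ := exists_parent hk
  obtain ⟨c, hc, eca⟩ := exists_parent ha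
  obtain ⟨d, hd, edb⟩ := exists_parent hb
  refine ⟨insert a (insert b (G.levelsLE z i)), ?_, ?_, ⟨a, Or.inl rfl, eah.symm⟩,
    ⟨b, Or.inr (Or.inl rfl), ebk.symm⟩, ?_⟩
  · refine Set.insert_subset ⟨_, le_rfl, ha⟩ (Set.insert_subset ⟨_, le_rfl, hb⟩ ?_)
    rintro x ⟨j, hj, hx⟩
    exact ⟨j, by omega, hx⟩
  · exact ((connOn_levelsLE z i).insert_of_adj ⟨i, le_rfl, hd⟩ edb.symm).insert_of_adj
      (Or.inr ⟨i, le_rfl, hc⟩) eca.symm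
  · rintro ⟨x, rfl | rfl | ⟨j, hj, hx⟩, e⟩
    · exact hhm.2 _ eah.symm e
    · exact hkm.2 _ ebk.symm e
    · exact (level_ne_not_adj hx hm (by omega)).2 e.symm

/-! ### Bounding the levels -/

/-- The ends of the walks of length three from `v`. -/
def ballThree (G : SimpleGraph V) (v : V) : Set V :=
  {x | ∃ a b, G.Adj v a ∧ G.Adj a b ∧ G.Adj b x}

/-- A level that is not `levelBound τ K`-colourable contains five rows and leaves a set that is not
`17 + 17 * K`-colourable, hence contains seventeen ported hubs if the sets covered by single hubs
are `K`-colourable. -/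
def levelBound (τ K : ℕ) : ℕ := (rowBound τ)^[5] (17 + 17 * K)

/-- If the balls of radius three have bounded chromatic number, then so have all levels: a hub of a
vertex outside the balls of radius three around other hubs is far from them. -/
lemma IsTrinity.colOn_level_of_ballThree [Finite V] (hG : G.IsTrinity) {τ T : ℕ}
    (hτ : ∀ v, G.ColOn (G.ballTwo v) τ) (hT : ∀ v, G.ColOn (G.ballThree v) T) (z : V) (k : ℕ) :
    G.ColOn (G.level Set.univ z (k + 3)) (levelBound τ T) := by
  by_contra hbig
  have hB := isHubSet_level (G := G) z k
  obtain ⟨W, E, hE, hEb, hW, hWW⟩ := hG.exists_rows hτ hB 5 (17 + 17 * T) _ subset_rfl hbig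
  refine hEb (hG.colOn_of_not_ported (B := G.level Set.univ z (k + 2)) G.Far
    (fun _ _ => Far.symm) (fun _ _ => True) (fun _ _ _ _ _ => trivial) G.ballThree hT ?_
    fun Z f p hfar => hG.not_isPorted hB hE hW hWW
      (fun h hh k hk m hm => exists_avoiding_levels hh hk hm) hfar)
  rintro Z hZ F hF ⟨x, hx, hxF⟩
  obtain ⟨h, hh, e⟩ := hB.exists_hub x (hE (hZ hx))
  refine ⟨h, hh, ⟨x, hx, e⟩, trivial, fun f hf => ⟨?_, fun q h1 h2 => ?_⟩⟩
  · rintro rfl; exact hxF _ hf ⟨x, _, e, e.symm, e⟩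
  · exact hxF f hf ⟨q, h, h1, h2.symm, e⟩

lemma indPath_two {h h' q : V} (hne : h ≠ h') (hnadj : ¬ G.Adj h h') (e : G.Adj h q)
    (e' : G.Adj q h') : G.IndPath (insert h (insert h' {q})) h h' 2 := by
  have h1 : G.IndPath {h, q} h q 1 := IndPath.edge (by simp) (by simp) e
  refine (h1.snoc e' ?_).mono ?_
  · rintro s (rfl | rfl) hs
    exacts [⟨hne, hnadj⟩, (hs rfl).elim]
  · intro s; simp; tauto

lemma IsTrinity.indPath_four (hG : G.IsTrinity) {h h' q q' z : V} (hne : h ≠ h')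
    (hnadj : ¬ G.Adj h h') (hz : h ≠ z ∧ ¬ G.Adj h z) (hz' : h' ≠ z ∧ ¬ G.Adj h' z)
    (e₁ : G.Adj h q) (e₂ : G.Adj z q) (e₃ : G.Adj z q') (e₄ : G.Adj h' q')
    (hq : ¬ G.Adj h' q) (hq' : ¬ G.Adj h q') :
    G.IndPath (insert h (insert h' {q, z, q'})) h h' 4 := by
  have h1 : G.IndPath {h, q} h q 1 := IndPath.edge (by simp) (by simp) e₁
  have h2 := h1.snoc e₂.symm (by
    rintro s (rfl | rfl) hs
    exacts [hz, (hs rfl).elim])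
  have h3 := h2.snoc e₃ (by
    rintro s (rfl | rfl | rfl) hs
    · exact (hs rfl).elim
    · exact ⟨by rintro rfl; exact hz.2 e₃.symm, hq'⟩
    · exact ⟨by rintro rfl; exact hq e₄, fun e => hG.not_triangle e₂ e e₃⟩)
  have h4 := h3.snoc e₄.symm (by
    rintro s (rfl | rfl | rfl | rfl) hs
    · exact (hs rfl).elim
    · exact ⟨hz'.1.symm, fun e => hz'.2 e.symm⟩
    · exact ⟨hne, hnadj⟩
    · exact ⟨by rintro rfl; exact hnadj e₁, fun e => hq e.symm⟩)
  refine h4.mono ?_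
  intro s; simp; tauto

/-- Two vertices `h`, `h'` off `z` with a common neighbour `x` off `z`: if they have neighbours `q`
and `q'` in common with `z`, then one of these is adjacent to both, for otherwise
`h x h' q' z q` is a hole of length six. -/
lemma IsTrinity.nested_of_common (hG : G.IsTrinity) {h h' q q' z x : V} (hne : h ≠ h')
    (hz : h ≠ z ∧ ¬ G.Adj h z) (hz' : h' ≠ z ∧ ¬ G.Adj h' z) (ex : G.Adj h x) (ex' : G.Adj h' x)
    (hxz : x ≠ z ∧ ¬ G.Adj x z)
    (e₁ : G.Adj h q) (e₂ : G.Adj z q) (e₃ : G.Adj z q') (e₄ : G.Adj h' q') :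
    G.Adj h' q ∨ G.Adj h q' := by
  by_contra! hcon
  have hnadj : ¬ G.Adj h h' := fun e => hG.not_triangle e ex' ex
  refine hG.not_dvd_of_links hne hnadj ?_ (indPath_two hne hnadj ex ex'.symm)
    (hG.indPath_four hne hnadj hz hz' e₁ e₂ e₃ e₄ hcon.1 hcon.2) (by norm_num)
  rintro s rfl t (rfl | rfl | rfl)
  · exact ⟨by rintro rfl; exact hxz.2 e₂.symm, fun e => hG.not_triangle ex e e₁⟩
  · exact hxz
  · exact ⟨by rintro rfl; exact hxz.2 e₃.symm, fun e => hG.not_triangle ex' e e₄⟩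

/-- The neighbourhoods of hubs in the first level form a laminar family: if two of them meet but
are not nested, then the two hubs have links of lengths `2` and `4`, so all their links through rows
have length `0` modulo three, and two rows give a hole. -/
lemma IsTrinity.laminar (hG : G.IsTrinity) {z h h' q q₁ q₂ : V} {W W' : Set V}
    (hh : h ∈ G.level Set.univ z 2) (hh' : h' ∈ G.level Set.univ z 2)
    (hW : W ⊆ G.level Set.univ z 3) (hW' : W' ⊆ G.level Set.univ z 3) (hc : G.ConnOn W)
    (hc' : G.ConnOn W') (hWW : G.Anticomplete W W') (t : G.Touches h W) (t' : G.Touches h' W)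
    (u : G.Touches h W') (u' : G.Touches h' W')
    (hq : G.Adj h q) (hq' : G.Adj h' q) (hzq : G.Adj z q) (hq₁ : G.Adj h q₁) (hzq₁ : G.Adj z q₁)
    (hq₂ : G.Adj h' q₂) (hzq₂ : G.Adj z q₂) : G.Adj h' q₁ ∨ G.Adj h q₂ := by
  by_contra! hcon
  have hne : h ≠ h' := by rintro rfl; exact hcon.1 hq₁
  have hnadj : ¬ G.Adj h h' := fun e => hG.not_triangle e hq' hq
  have hz0 : ∀ x ∈ G.level Set.univ z 2, x ≠ z ∧ ¬ G.Adj x z := fun x hx =>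
    have := level_ne_not_adj (level_zero.2 rfl) hx (by omega)
    ⟨this.1.symm, fun e => this.2 e.symm⟩
  have two := indPath_two hne hnadj hq hq'.symm
  have four := hG.indPath_four hne hnadj (hz0 h hh) (hz0 h' hh') hq₁ hzq₁ hzq₂ hq₂ hcon.1 hcon.2
  have key : ∀ S ⊆ G.level Set.univ z 3, G.ConnOn S → G.Touches h S → G.Touches h' S →
      ∃ n, G.IndPath (insert h (insert h' S)) h h' n ∧ n % 3 = 0 := by
    intro S hS hSc hhS hhS'
    obtain ⟨n, hn⟩ := hSc.exists_indPath hhS hhS'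
    have low : ∀ s ∈ S, ∀ x, G.Adj z x ∨ x = z → x ≠ s ∧ ¬ G.Adj x s := by
      rintro s hs x (e | rfl)
      · exact level_ne_not_adj (level_univ_one e) (hS hs) (by omega)
      · exact level_ne_not_adj (level_zero.2 rfl) (hS hs) (by omega)
    have f1 := hG.not_dvd_of_links hne hnadj (S := {q}) (T := S) (by
      rintro x rfl s hs; exact low s hs x (Or.inl hzq)) two hn
    have f2 := hG.not_dvd_of_links hne hnadj (S := {q₁, z, q₂}) (T := S) (by
      rintro x (rfl | rfl | rfl) s hs
      exacts [low s hs _ (Or.inl hzq₁), low s hs _ (Or.inr rfl), low s hs _ (Or.inl hzq₂)]) four hn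
    exact ⟨n, hn, by omega⟩
  obtain ⟨n, hn, hn0⟩ := key W hW hc t t'
  obtain ⟨m, hm, hm0⟩ := key W' hW' hc' u u'
  exact hG.not_dvd_of_links hne hnadj hWW hn hm (by omega)

/-- The third level has bounded chromatic number. Here hubs are picked with an inclusion-minimal
neighbourhood in the first level, which is laminar; a hub `h` that is not adjacent to the chosen
parents `a f` of the earlier hubs `f` has no common neighbour with them. -/
lemma IsTrinity.colOn_level_three [Finite V] (hG : G.IsTrinity) {τ : ℕ}
    (hτ : ∀ v, G.ColOn (G.ballTwo v) τ) (z : V) :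
    G.ColOn (G.level Set.univ z 3) (levelBound τ τ) := by
  classical
  by_contra hbig
  have hB := isHubSet_level (G := G) z 0
  obtain ⟨W, E, hE, hEb, hW, hWW⟩ := hG.exists_rows hτ hB 5 (17 + 17 * τ) _ subset_rfl hbig
  have hpar : ∀ f, ∃ a, f ∈ G.level Set.univ z 2 → G.Adj z a ∧ G.Adj f a := by
    intro f
    by_cases hf : f ∈ G.level Set.univ z 2
    · obtain ⟨a, ha, e⟩ := exists_parent hf
      exact ⟨a, fun _ => ⟨adj_of_mem_level_one ha, e.symm⟩⟩
    · exact ⟨z, fun h => (hf h).elim⟩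
  choose a ha using hpar
  have hz0 : ∀ x ∈ G.level Set.univ z 2, x ≠ z ∧ ¬ G.Adj x z := fun x hx =>
    have := level_ne_not_adj (level_zero.2 rfl) hx (by omega)
    ⟨this.1.symm, fun e => this.2 e.symm⟩
  refine hEb (hG.colOn_of_not_ported (B := G.level Set.univ z 2) G.Far
    (fun _ _ => Far.symm)
    (fun f Z => ∀ h ∈ G.level Set.univ z 2, G.Touches h Z →
      ∀ q, G.Adj z q → G.Adj f q → G.Adj h q → G.Adj h (a f))
    (fun f Z Z' hf hZ h hh hhZ => hf h hh (hhZ.mono hZ)) (fun f => G.ballTwo (a f))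
    (fun f => hτ _) ?_
    fun Z f p hfar => hG.not_isPorted hB hE hW hWW
      (fun h hh k hk m hm => exists_avoiding_levels hh hk hm) hfar)
  rintro Z hZ F hF ⟨x, hx, hxF⟩
  obtain ⟨h₀, hh₀, e₀⟩ := hB.exists_hub x (hE (hZ hx))
  obtain ⟨h, ⟨hh, hhZ, hhF⟩, hmin⟩ := Set.exists_min_image
    {h | h ∈ G.level Set.univ z 2 ∧ G.Touches h Z ∧ ∀ f ∈ F, ¬ G.Adj h (a f)}
    (fun h => {q | G.Adj z q ∧ G.Adj h q}.ncard) (Set.toFinite _)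
    ⟨h₀, hh₀, ⟨x, hx, e₀⟩, fun f hf e => hxF f hf ⟨h₀, e.symm, e₀⟩⟩
  refine ⟨h, hh, hhZ, fun h' hh' hhZ' q hzq hq hq' => ?_, fun f hf => ⟨?_, fun q hfq hhq => ?_⟩⟩
  · by_contra hn
    -- by laminarity, the neighbourhood of `h'` would be smaller
    have hsub : ∀ q, G.Adj z q → G.Adj h' q → G.Adj h q := by
      intro q₂ hzq₂ hq₂
      refine (hG.laminar hh hh' (hW 0).1 (hW 1).1 (hW 0).2.1 (hW 1).2.1 (hWW 0 1 (by decide))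
        ((hW 0).2.2.2 h hh (hhZ.mono hZ)) ((hW 0).2.2.2 h' hh' (hhZ'.mono hZ))
        ((hW 1).2.2.2 h hh (hhZ.mono hZ)) ((hW 1).2.2.2 h' hh' (hhZ'.mono hZ)) hq hq' hzq
        (ha h hh).2 (ha h hh).1 hq₂ hzq₂).resolve_left hn
    have hle := hmin h' ⟨hh', hhZ', fun f hf e => hhF f hf (hsub _ (ha f (hF f hf).1).1 e)⟩
    have hlt : {q | G.Adj z q ∧ G.Adj h' q}.ncard < {q | G.Adj z q ∧ G.Adj h q}.ncard :=
      Set.ncard_lt_ncard ⟨fun q hq => ⟨hq.1, hsub q hq.1 hq.2⟩,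
        fun hs => hn (hs ⟨(ha h hh).1, (ha h hh).2⟩).2⟩ (Set.toFinite _)
    exact absurd hle (by simpa using hlt)
  · rintro rfl; exact hhF _ hf (ha _ hh).2
  · obtain ⟨hfB, hfg⟩ := hF f hf
    have hshare : ∀ q, G.Adj z q → G.Adj f q → ¬ G.Adj h q := fun q h1 h2 h3 =>
      hhF f hf (hfg h hh hhZ q h1 h2 h3)
    have hqz : q ≠ z ∧ ¬ G.Adj q z :=
      ⟨by rintro rfl; exact (hz0 f hfB).2 hfq, fun e => hshare q e.symm hfq hhq⟩
    have hne : f ≠ h := by rintro rfl; exact hhF _ hf (ha _ hh).2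
    rcases hG.nested_of_common hne (hz0 f hfB) (hz0 h hh) hfq hhq hqz (ha f hfB).2 (ha f hfB).1
      (ha h hh).1 (ha h hh).2 with e | e
    · exact hhF f hf e
    · exact hshare _ (ha h hh).1 e (ha h hh).2

/-! ### From balls of radius two to the whole graph -/

/-- A bound for the chromatic number in terms of that of the balls of radius two. -/
def graphBound (τ : ℕ) : ℕ := 2 * (levelBound τ (τ + 2 + levelBound τ τ) + (τ + 2))

lemma IsTrinity.colOn_level_of_lt_three (hG : G.IsTrinity) {τ : ℕ}
    (hτ : ∀ v, G.ColOn (G.ballTwo v) τ) (z : V) :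
    G.ColOn (G.level Set.univ z 0 ∪ G.level Set.univ z 1 ∪ G.level Set.univ z 2) (τ + 2) := by
  have h0 : G.ColOn (G.level Set.univ z 0) 1 := ColOn.of_indep fun x hx y hy e => by
    rw [level_zero] at hx hy
    rw [hx, hy] at e
    exact G.irrefl e
  have h1 : G.ColOn (G.level Set.univ z 1) 1 :=
    (hG.colOn_neighbors z).mono (fun x hx => adj_of_mem_level_one hx) le_rfl
  have h2 : G.ColOn (G.level Set.univ z 2) τ := (hτ z).mono (fun x hx => by
    obtain ⟨d, hd, e⟩ := exists_parent hx
    exact ⟨d, adj_of_mem_level_one hd, e⟩) le_rfl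
  exact ((h0.union h1).union h2).mono subset_rfl (by omega)

lemma IsTrinity.colOn_ballThree [Finite V] (hG : G.IsTrinity) {τ : ℕ}
    (hτ : ∀ v, G.ColOn (G.ballTwo v) τ) (z : V) :
    G.ColOn (G.ballThree z) (τ + 2 + levelBound τ τ) := by
  refine ((hG.colOn_level_of_lt_three hτ z).union (hG.colOn_level_three hτ z)).mono ?_ le_rfl
  rintro x ⟨a, b, e₁, e₂, e₃⟩
  have ha := level_univ_one e₁
  have hx : ∀ y, (G.within Set.univ).Reachable z y →
      y ∈ G.level Set.univ z ((G.within Set.univ).dist z y) := fun y hy => ⟨hy, rfl⟩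
  have hb := hx b (ha.1.trans (reachable_within_adj trivial trivial e₂))
  have hx := hx x (hb.1.trans (reachable_within_adj trivial trivial e₃))
  have h1 := level_adj_le (Set.mem_univ z) ha hb e₂
  have h2 := level_adj_le (Set.mem_univ z) hb hx e₃
  generalize (G.within Set.univ).dist z x = j at *
  rcases (by omega : j = 0 ∨ j = 1 ∨ j = 2 ∨ j = 3) with rfl | rfl | rfl | rfl
  exacts [Or.inl (Or.inl (Or.inl hx)), Or.inl (Or.inl (Or.inr hx)), Or.inl (Or.inr hx), Or.inr hx]

/-- Bounded balls of radius two give bounded third levels, hence bounded balls of radius three,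
hence bounded levels. -/
lemma IsTrinity.colOn_univ_of_ballTwo [Finite V] (hG : G.IsTrinity) {τ : ℕ}
    (hτ : ∀ v, G.ColOn (G.ballTwo v) τ) : G.ColOn Set.univ (graphBound τ) := by
  by_contra hbig
  obtain ⟨C, -, hC, -, ⟨z, hz⟩, hCb⟩ := exists_big_component hbig
  obtain ⟨j, hj⟩ := exists_big_level (G := G) (Set.mem_univ z)
    (fun x hx => reachable_within_mono (Set.subset_univ C) (hC z hz x hx)) hCb
  refine hj ?_
  by_cases h3 : j < 3
  · refine (hG.colOn_level_of_lt_three hτ z).mono ?_ (Nat.le_add_left _ _)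
    intro x hx
    interval_cases j
    exacts [Or.inl (Or.inl hx), Or.inl (Or.inr hx), Or.inr hx]
  · obtain ⟨k, rfl⟩ : ∃ k, j = k + 3 := ⟨j - 3, by omega⟩
    exact (hG.colOn_level_of_ballThree hτ (hG.colOn_ballThree hτ) z k).mono subset_rfl
      (Nat.le_add_right _ _)

/-! ### The second neighbourhood of a vertex -/

/-- The vertices at distance two from `v`. -/
def secondNeighbors (G : SimpleGraph V) (v : V) : Set V :=
  {x | x ≠ v ∧ ¬ G.Adj x v ∧ ∃ q, G.Adj v q ∧ G.Adj x q}

/-- The second neighbourhood of `v` contains no cycle of length five: along it, the sets of common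
neighbours with `v` are nested at distance two, disjoint at distance one, and nonempty. A minimal
one would be contained in two disjoint ones. -/
lemma IsTrinity.no_five_cycle [Finite V] (hG : G.IsTrinity) {v : V} {x : Fin 5 → V}
    (hx : ∀ i, x i ∈ G.secondNeighbors v) (hadj : ∀ i, G.Adj (x i) (x (i + 1))) : False := by
  have hfive : ∀ i : Fin 5, i + 1 + 1 + 1 + 1 + 1 = i := by decide
  let T : Fin 5 → Set V := fun i => {q | G.Adj v q ∧ G.Adj (x i) q}
  obtain ⟨i, -, hi⟩ := Set.exists_min_image Set.univ (fun i => (T i).ncard) (Set.toFinite _)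
    ⟨0, trivial⟩
  have hne : ∀ i, x i ≠ x (i + 1 + 1) := by
    intro i h
    have h1 := hadj (i + 1 + 1)
    have h2 := hadj (i + 1 + 1 + 1)
    have h3 := hadj (i + 1 + 1 + 1 + 1)
    have h5 := hfive i
    rw [h5, h] at h3
    exact hG.not_triangle h1 h2 h3.symm
  have hnest : ∀ i, T i ⊆ T (i + 1 + 1) ∨ T (i + 1 + 1) ⊆ T i := by
    intro i
    by_contra! hcon
    obtain ⟨⟨q, ⟨hvq, hq⟩, hq'⟩, q', ⟨hvq', hq₁⟩, hq₂⟩ :=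
      And.intro (Set.not_subset.1 hcon.1) (Set.not_subset.1 hcon.2)
    obtain ⟨a1, a2, -⟩ := hx i
    obtain ⟨b1, b2, -⟩ := hx (i + 1)
    obtain ⟨c1, c2, -⟩ := hx (i + 1 + 1)
    rcases hG.nested_of_common (hne i) ⟨a1, a2⟩ ⟨c1, c2⟩ (hadj i) (hadj (i + 1)).symm ⟨b1, b2⟩
      hq hvq hvq' hq₁ with e | e
    exacts [hq' ⟨hvq, e⟩, hq₂ ⟨hvq', e⟩]
  have hmin : ∀ j, T i ⊆ T j ∨ T j ⊆ T i → T i ⊆ T j := by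
    rintro j (h | h)
    · exact h
    · exact (Set.eq_of_subset_of_ncard_le h (hi j trivial) (Set.toFinite _)).ge
  have h2 := hmin _ (hnest i)
  have h5 := hfive i
  have h3 := hmin (i + 1 + 1 + 1) (by
    have := hnest (i + 1 + 1 + 1)
    rw [h5] at this
    exact this.symm)
  obtain ⟨-, -, q, hvq, hq⟩ := hx i
  exact hG.not_triangle (hadj (i + 1 + 1)) (h3 ⟨hvq, hq⟩).2 (h2 ⟨hvq, hq⟩).2

lemma IsTrinity.induce (hG : G.IsTrinity) (S : Set V) : (G.induce S).IsTrinity :=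
  fun k h3 hk h => hG k h3 hk (h.trans ⟨Embedding.induce S⟩)

/-- In the graph induced on the second neighbourhood of `v` balls of radius two are stable, since an
edge in such a ball closes to a cycle of length five. -/
lemma IsTrinity.colOn_ballTwo [Finite V] (hG : G.IsTrinity) (v : V) :
    G.ColOn (G.ballTwo v) (graphBound 1 + 1) := by
  have hH := hG.induce (G.secondNeighbors v)
  have hball : ∀ u, (G.induce (G.secondNeighbors v)).ColOn
      ((G.induce (G.secondNeighbors v)).ballTwo u) 1 := by
    intro u
    refine ColOn.of_indep ?_
    rintro x ⟨d, hud, hdx⟩ y ⟨d', hud', hdy⟩ e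
    refine hG.no_five_cycle (v := v) (x := fun i => (![u, d, x, y, d'] i).1)
      (fun i => Subtype.prop _)
      fun i => ?_
    have h1 : G.Adj u d := hud
    have h2 : G.Adj d x := hdx
    have h3 : G.Adj x y := e
    have h4 : G.Adj y d' := hdy.symm
    have h5 : G.Adj d' u := hud'.symm
    fin_cases i
    exacts [h1, h2, h3, h4, h5]
  obtain ⟨c, hc, hcc⟩ := hH.colOn_univ_of_ballTwo hball
  have hsec : G.ColOn (G.secondNeighbors v) (graphBound 1) := by
    classical
    refine ⟨fun x => if hx : x ∈ G.secondNeighbors v then c ⟨x, hx⟩ else 0, fun x hx => ?_,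
      fun x hx y hy e => ?_⟩
    · simp only [hx, dif_pos]; exact hc _ trivial
    · simp only [hx, hy, dif_pos]; exact hcc _ trivial _ trivial e
  have hv : G.ColOn {v} 1 := ColOn.of_indep (by rintro x rfl y rfl e; exact G.irrefl e)
  refine (hsec.union hv).mono ?_ le_rfl
  rintro x ⟨d, h1, h2⟩
  by_cases hxv : x = v
  · exact Or.inr hxv
  · exact Or.inl ⟨hxv, fun e => hG.not_triangle h1 h2 e.symm, d, h1, h2.symm⟩

lemma IsTrinity.colorable_of_finite [Finite V] (hG : G.IsTrinity) :
    G.Colorable (graphBound (graphBound 1 + 1)) := by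
  obtain ⟨c, hc, hcc⟩ := hG.colOn_univ_of_ballTwo hG.colOn_ballTwo
  exact ⟨Coloring.mk (fun x => ⟨c x, hc x trivial⟩) fun {x y} e h =>
    hcc x trivial y trivial e (Fin.mk.inj h)⟩

/-- The theorem of de Bruijn and Erdős removes the finiteness assumption. -/
lemma IsTrinity.colorable (hG : G.IsTrinity) :
    G.Colorable (graphBound (graphBound 1 + 1)) := by
  refine nonempty_hom_of_forall_finite_subgraph_hom fun G' hG' => ?_
  haveI : Finite G'.verts := hG'
  have : (G.induce G'.verts).Colorable _ := (hG.induce G'.verts).colorable_of_finite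
  exact (this.some).comp (Hom.ofLE fun x y e => G'.adj_sub e)

/-! ### The Euler characteristic of the independence complex -/

/-- Chains as formal sums of finite sets of vertices. -/
noncomputable def chainVal (G : SimpleGraph V) (k : ℕ) : G.IndepChain k →ₗ[ℤ] (Finset V →₀ ℤ) :=
  Finsupp.lmapDomain ℤ ℤ fun s => s.1

lemma chainVal_injective (k : ℕ) : Function.Injective (G.chainVal k) :=
  Finsupp.mapDomain_injective Subtype.val_injective

section Euler

variable [LinearOrder V]

/-- The boundary map on formal sums of arbitrary finite sets, of which all maps `indepBoundary` are
restrictions. -/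
noncomputable def setBoundary (V : Type*) [LinearOrder V] :
    (Finset V →₀ ℤ) →ₗ[ℤ] (Finset V →₀ ℤ) :=
  Finsupp.linearCombination ℤ fun s =>
    ∑ v ∈ s, Finsupp.single (s.erase v) ((-1 : ℤ) ^ (s.filter (· < v)).card)

/-- Deleting `v` lowers the position of `w` by one if `v < w`. -/
lemma card_filter_erase_lt (s : Finset V) {v w : V} (hv : v ∈ s) :
    ((s.erase v).filter (· < w)).card + (if v < w then 1 else 0) = (s.filter (· < w)).card := by
  rw [Finset.filter_erase]
  split_ifs with h
  · exact Finset.card_erase_add_one (by simp [hv, h])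
  · rw [Finset.erase_eq_of_notMem (by simp [h]), add_zero]

lemma setBoundary_comp_self : setBoundary V ∘ₗ setBoundary V = 0 := by
  refine Finsupp.lhom_ext' fun s => LinearMap.ext_ring ?_
  simp only [LinearMap.comp_apply, Finsupp.lsingle_apply, LinearMap.zero_apply, setBoundary,
    Finsupp.linearCombination_single, one_smul, map_sum, Finset.smul_sum, Finsupp.smul_single,
    smul_eq_mul]
  rw [Finset.sum_sigma']
  -- removing two vertices in either order gives opposite signs
  refine Finset.sum_involution (fun p _ => ⟨p.2, p.1⟩) ?_ ?_ ?_ ?_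
  · rintro ⟨v, w⟩ hp
    simp only [Finset.mem_sigma, Finset.mem_erase] at hp
    obtain ⟨hv, hwv, hw⟩ := hp
    dsimp only
    rw [Finset.erase_right_comm, ← Finsupp.single_add, Finsupp.single_eq_zero]
    have h1 := card_filter_erase_lt s (w := w) hv
    have h2 := card_filter_erase_lt s (w := v) hw
    rcases lt_or_gt_of_ne hwv with h | h
    · rw [if_neg h.not_gt] at h1
      rw [if_pos h] at h2
      rw [← h1, ← h2]
      ring
    · rw [if_pos h] at h1
      rw [if_neg h.not_gt] at h2
      rw [← h1, ← h2]
      ring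
  · rintro ⟨v, w⟩ hp - h
    simp only [Finset.mem_sigma, Finset.mem_erase] at hp
    simp only [Sigma.mk.injEq] at h
    exact hp.2.1 h.1
  · rintro ⟨v, w⟩ hp
    simp only [Finset.mem_sigma, Finset.mem_erase] at hp ⊢
    exact ⟨hp.2.2, hp.2.1.symm, hp.1⟩
  · rintro ⟨v, w⟩ _
    rfl

lemma chainVal_indepBoundary (k : ℕ) :
    G.chainVal k ∘ₗ G.indepBoundary k = setBoundary V ∘ₗ G.chainVal (k + 1) := by
  refine Finsupp.lhom_ext' fun s => LinearMap.ext_ring ?_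
  simp only [LinearMap.comp_apply, Finsupp.lsingle_apply, indepBoundary, setBoundary, chainVal,
    Finsupp.linearCombination_single, one_smul, map_sum, Finsupp.lmapDomain_apply,
    Finsupp.mapDomain_single]
  exact Finset.sum_attach s.1 fun v =>
    Finsupp.single (s.1.erase v) ((-1 : ℤ) ^ (s.1.filter (· < v)).card)

lemma range_indepBoundary_le (k : ℕ) : LinearMap.range (G.indepBoundary k) ≤ G.indepCycles k := by
  cases k with
  | zero => exact le_top
  | succ k =>
    rintro _ ⟨x, rfl⟩
    refine LinearMap.mem_ker.2 (chainVal_injective k ?_)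
    have h1 := LinearMap.congr_fun (chainVal_indepBoundary (G := G) k) (G.indepBoundary (k + 1) x)
    have h2 := LinearMap.congr_fun (chainVal_indepBoundary (G := G) (k + 1)) x
    have h3 := LinearMap.congr_fun (setBoundary_comp_self (V := V)) (G.chainVal (k + 2) x)
    simp only [LinearMap.comp_apply, LinearMap.zero_apply] at h1 h2 h3
    rw [h1, h2, h3, map_zero]

variable [Fintype V]

instance (k : ℕ) : Finite (G.IndepFace k) := inferInstanceAs (Finite (Subtype _))

lemma indepBetti_add_finrank_range (k : ℕ) :
    G.indepBetti k + Module.finrank ℤ (LinearMap.range (G.indepBoundary k)) =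
      Module.finrank ℤ (G.indepCycles k) := by
  rw [← (Submodule.submoduleOfEquivOfLe (range_indepBoundary_le k)).finrank_eq]
  exact Submodule.finrank_quotient_add_finrank _

lemma finrank_indepCycles_zero :
    Module.finrank ℤ (G.indepCycles 0) = Nat.card (G.IndepFace 0) := by
  have := Fintype.ofFinite (G.IndepFace 0)
  rw [show G.indepCycles 0 = ⊤ from rfl, finrank_top, Module.finrank_finsupp_self,
    Nat.card_eq_fintype_card]

lemma finrank_indepCycles_succ (k : ℕ) :
    Module.finrank ℤ (LinearMap.range (G.indepBoundary k)) +
      Module.finrank ℤ (G.indepCycles (k + 1)) = Nat.card (G.IndepFace (k + 1)) := by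
  have := Fintype.ofFinite (G.IndepFace (k + 1))
  rw [Nat.card_eq_fintype_card, ← Module.finrank_finsupp_self ℤ,
    ← (G.indepBoundary k).quotKerEquivRange.finrank_eq]
  exact Submodule.finrank_quotient_add_finrank _

/-- Euler's formula for the truncated complex: the alternating sums of the face numbers and of the
Betti numbers differ by the rank of the boundary map into the last chain group. -/
lemma sum_neg_one_pow_mul_card (n : ℕ) :
    ∑ k ∈ Finset.range (n + 1), (-1 : ℤ) ^ k * Nat.card (G.IndepFace k) =
      ∑ k ∈ Finset.range (n + 1), (-1 : ℤ) ^ k * G.indepBetti k +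
        (-1) ^ n * Module.finrank ℤ (LinearMap.range (G.indepBoundary n)) := by
  induction n with
  | zero =>
    have := indepBetti_add_finrank_range (G := G) 0
    rw [finrank_indepCycles_zero] at this
    simp [← this]
  | succ n ih =>
    rw [Finset.sum_range_succ, ih, Finset.sum_range_succ _ (n + 1), ← finrank_indepCycles_succ,
      ← indepBetti_add_finrank_range]
    push_cast
    ring

/-- The reduced Euler characteristic of the independence complex is a lower bound for the sum of
the reduced Betti numbers. -/
lemma abs_sum_neg_one_pow_card_le :
    |∑ k ∈ Finset.range (Fintype.card V + 1), (-1 : ℤ) ^ k * Nat.card (G.IndepFace k)| ≤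
      G.bettiSum := by
  have hzero : Module.finrank ℤ (LinearMap.range (G.indepBoundary (Fintype.card V))) = 0 := by
    have hempty : IsEmpty (G.IndepFace (Fintype.card V + 1)) :=
      ⟨fun s => by have := s.1.card_le_univ; have := s.2.2; omega⟩
    have := finrank_indepCycles_succ (G := G) (Fintype.card V)
    rw [Nat.card_of_isEmpty] at this
    omega
  rw [sum_neg_one_pow_mul_card, hzero, Nat.cast_zero, mul_zero, add_zero, bettiSum, Nat.cast_sum]
  refine (Finset.abs_sum_le_sum_abs _ _).trans (Finset.sum_le_sum fun k _ => ?_)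
  rw [abs_mul, abs_pow, abs_neg, abs_one, one_pow, one_mul, Nat.abs_cast]

lemma sum_indepSet_le_bettiSum [∀ s : Finset V, Decidable (G.IsIndepSet (s : Set V))] :
    |∑ s : Finset V, if G.IsIndepSet (s : Set V) then (-1 : ℤ) ^ s.card else 0| ≤ G.bettiSum := by
  refine le_of_eq_of_le (congrArg _ ?_) (abs_sum_neg_one_pow_card_le (G := G))
  rw [← Finset.sum_fiberwise_of_maps_to (t := Finset.range (Fintype.card V + 1))
    (g := fun s : Finset V => s.card) fun s _ => by
      have := s.card_le_univ; simp only [Finset.mem_range]; omega]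
  refine Finset.sum_congr rfl fun k _ => ?_
  have hcard : Nat.card (G.IndepFace k) =
      (Finset.univ.filter fun s : Finset V => G.IsIndepSet (s : Set V) ∧ s.card = k).card :=
    Nat.subtype_card _ (by simp)
  rw [← Finset.sum_filter, Finset.filter_filter, hcard,
    Finset.sum_congr (g := fun _ => (-1 : ℤ) ^ k) (Finset.filter_congr fun s _ => and_comm)
      fun s hs => by rw [(Finset.mem_filter.1 hs).2.2], Finset.sum_const, nsmul_eq_mul, mul_comm]

end Euler

/-! ### Cycles of length divisible by three -/

/-- The sum of `(-1) ^ |s|` over the sets `s ⊆ {0, …, n - 1}` without consecutive elements and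
disjoint from `Z`. -/
def pathSum (Z : Finset ℕ) (n : ℕ) : ℤ :=
  ∑ s ∈ (Finset.range n).powerset,
    if (∀ i ∈ s, i + 1 ∉ s) ∧ Disjoint s Z then (-1 : ℤ) ^ s.card else 0

/-- The sets counted by `pathSum Z (n + 2)` that contain `n + 1` do not contain `n`, and
contribute `- pathSum Z n`. -/
lemma sum_insert_eq_neg_pathSum (Z : Finset ℕ) (n : ℕ) (hZ : n + 1 ∉ Z) :
    ∑ s ∈ (Finset.range (n + 1)).powerset,
      (if (∀ i ∈ insert (n + 1) s, i + 1 ∉ insert (n + 1) s) ∧ Disjoint (insert (n + 1) s) Z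
        then (-1 : ℤ) ^ (insert (n + 1) s).card else 0) = - pathSum Z n := by
  have hn : n ∉ Finset.range n := by simp
  rw [Finset.range_add_one, Finset.sum_powerset_insert hn, pathSum, ← Finset.sum_neg_distrib]
  rw [Finset.sum_eq_zero (s := (Finset.range n).powerset)
    (f := fun t => if (∀ i ∈ insert (n + 1) (insert n t), i + 1 ∉ insert (n + 1) (insert n t)) ∧
      Disjoint (insert (n + 1) (insert n t)) Z
      then (-1 : ℤ) ^ (insert (n + 1) (insert n t)).card else 0) fun t _ =>
      if_neg fun h => h.1 n (by simp) (by simp), add_zero]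
  refine Finset.sum_congr rfl fun t ht => ?_
  have hlt : ∀ i ∈ t, i < n := fun i hi => Finset.mem_range.1 (Finset.mem_powerset.1 ht hi)
  have hnt : n + 1 ∉ t := fun h => by have := hlt _ h; omega
  have hiff : ((∀ i ∈ insert (n + 1) t, i + 1 ∉ insert (n + 1) t) ∧
      Disjoint (insert (n + 1) t) Z) ↔ (∀ i ∈ t, i + 1 ∉ t) ∧ Disjoint t Z := by
    rw [Finset.disjoint_insert_left]
    refine ⟨fun h => ⟨fun i hi hi' => h.1 i (by simp [hi]) (by simp [hi']), h.2.2⟩,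
      fun h => ⟨fun i hi hi' => ?_, hZ, h.2⟩⟩
    simp only [Finset.mem_insert] at hi hi'
    rcases hi with rfl | hi <;> rcases hi' with hi' | hi'
    · omega
    · have := hlt _ hi'; omega
    · have := hlt _ hi; omega
    · exact h.1 i hi hi'
  rw [if_congr hiff rfl rfl, Finset.card_insert_of_notMem hnt]
  split_ifs
  · ring
  · ring

lemma pathSum_add_two (Z : Finset ℕ) (n : ℕ) (hZ : n + 1 ∉ Z) :
    pathSum Z (n + 2) = pathSum Z (n + 1) - pathSum Z n := by
  have hn' : n + 1 ∉ Finset.range (n + 1) := by simp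
  rw [sub_eq_add_neg, ← sum_insert_eq_neg_pathSum Z n hZ, pathSum, Finset.range_add_one,
    Finset.sum_powerset_insert hn', pathSum]

lemma pathSum_add_three (Z : Finset ℕ) (n : ℕ) (hZ : n + 1 ∉ Z) (hZ' : n + 2 ∉ Z) :
    pathSum Z (n + 3) = - pathSum Z n := by
  rw [pathSum_add_two Z (n + 1) hZ', pathSum_add_two Z n hZ]
  ring

lemma cycleGraph_adj_iff_val {n : ℕ} {u v : Fin (n + 2)} : (cycleGraph (n + 2)).Adj u v ↔
    u.val + 1 = v.val ∨ v.val + 1 = u.val ∨ (u.val = 0 ∧ v.val = n + 1) ∨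
      (v.val = 0 ∧ u.val = n + 1) := by
  rw [cycleGraph_adj']
  have := u.2
  have := v.2
  rcases lt_trichotomy u v with h | h | h
  · rw [Fin.sub_val_of_le h.le, Fin.coe_sub_iff_lt.2 h]
    have : u.val < v.val := h
    omega
  · subst h
    simp only [sub_self, Fin.val_zero]
    omega
  · rw [Fin.sub_val_of_le h.le, Fin.coe_sub_iff_lt.2 h]
    have : v.val < u.val := h
    omega

lemma isIndepSet_cycleGraph_iff {n : ℕ} (s : Finset (Fin (n + 2))) :
    (cycleGraph (n + 2)).IsIndepSet (s : Set (Fin (n + 2))) ↔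
      (∀ i ∈ s.map Fin.valEmbedding, i + 1 ∉ s.map Fin.valEmbedding) ∧
        ¬ (0 ∈ s.map Fin.valEmbedding ∧ n + 1 ∈ s.map Fin.valEmbedding) := by
  simp only [Finset.mem_map, Fin.valEmbedding_apply]
  constructor
  · refine fun h => ⟨?_, ?_⟩
    · rintro _ ⟨u, hu, rfl⟩ ⟨v, hv, e⟩
      exact h hu hv (by rintro rfl; omega) (cycleGraph_adj_iff_val.2 (Or.inl e.symm))
    · rintro ⟨⟨u, hu, eu⟩, v, hv, ev⟩
      exact h hu hv (by rintro rfl; omega)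
        (cycleGraph_adj_iff_val.2 (Or.inr (Or.inr (Or.inl ⟨eu, ev⟩))))
  · rintro ⟨h1, h2⟩ u hu v hv - e
    rcases cycleGraph_adj_iff_val.1 e with e | e | e | e
    · exact h1 _ ⟨u, hu, rfl⟩ ⟨v, hv, e.symm⟩
    · exact h1 _ ⟨v, hv, rfl⟩ ⟨u, hu, e.symm⟩
    · exact h2 ⟨⟨u, hu, e.1⟩, v, hv, e.2⟩
    · exact h2 ⟨⟨v, hv, e.1⟩, u, hu, e.2⟩

/-- Stable sets of the cycle of length `n + 2` that do not contain `n + 1` are stable sets of the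
path on `n + 1` vertices; those that contain `n + 1` contain neither `n` nor `0`. -/
lemma sum_indepSet_cycleGraph (n : ℕ)
    [∀ s : Finset (Fin (n + 2)),
      Decidable ((cycleGraph (n + 2)).IsIndepSet (s : Set (Fin (n + 2))))] :
    (∑ s : Finset (Fin (n + 2)), if (cycleGraph (n + 2)).IsIndepSet (s : Set (Fin (n + 2)))
      then (-1 : ℤ) ^ s.card else 0) = pathSum ∅ (n + 1) - pathSum {0} n := by
  have hn : n + 1 ∉ Finset.range (n + 1) := by simp
  trans ∑ t ∈ (Finset.range (n + 2)).powerset,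
    if (∀ i ∈ t, i + 1 ∉ t) ∧ ¬ (0 ∈ t ∧ n + 1 ∈ t) then (-1 : ℤ) ^ t.card else 0
  · refine Finset.sum_bij (fun s _ => s.map Fin.valEmbedding) ?_ ?_ ?_ ?_
    · intro s _
      rw [Finset.mem_powerset]
      intro i hi
      obtain ⟨u, -, rfl⟩ := Finset.mem_map.1 hi
      exact Finset.mem_range.2 u.2
    · exact fun s _ t _ h => Finset.map_injective _ h
    · intro t ht
      rw [Finset.mem_powerset] at ht
      exact ⟨t.attachFin fun m hm => Finset.mem_range.1 (ht hm), Finset.mem_univ _, 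
        Finset.map_valEmbedding_attachFin _⟩
    · intro s _
      rw [Finset.card_map]
      exact if_congr (isIndepSet_cycleGraph_iff s) rfl rfl
  rw [Finset.range_add_one, Finset.sum_powerset_insert hn, sub_eq_add_neg,
    ← sum_insert_eq_neg_pathSum {0} n (by simp), pathSum]
  congr 1
  · refine Finset.sum_congr rfl fun t ht => if_congr (and_congr_right fun _ => ?_) rfl rfl
    simp only [Finset.disjoint_empty_right, iff_true, not_and]
    exact fun _ h => hn (Finset.mem_powerset.1 ht h)
  · refine Finset.sum_congr rfl fun t _ => if_congr (and_congr_right fun _ => ?_) rfl rfl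
    simp

lemma pathSum_values (m : ℕ) :
    pathSum ∅ (3 * m + 2) = - (-1) ^ m ∧ pathSum {0} (3 * m + 1) = (-1) ^ m := by
  induction m with
  | zero => constructor <;> decide
  | succ m ih =>
    rw [show 3 * (m + 1) + 2 = 3 * m + 2 + 3 by ring, show 3 * (m + 1) + 1 = 3 * m + 1 + 3 by ring,
      pathSum_add_three _ _ (by simp) (by simp), pathSum_add_three _ _ (by simp) (by simp), ih.1,
      ih.2]
    constructor <;> ring

/-- The independence complex of a cycle of length divisible by three has reduced Euler
characteristic `± 2`. -/
lemma one_lt_bettiSum_cycleGraph {k : ℕ} (hk : 3 ≤ k) (h3 : 3 ∣ k) :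
    1 < (cycleGraph k).bettiSum := by
  classical
  obtain ⟨m, rfl⟩ : ∃ m, k = 3 * m + 1 + 2 := by
    obtain ⟨l, rfl⟩ := h3
    exact ⟨l - 1, by omega⟩
  have h := sum_indepSet_le_bettiSum (G := cycleGraph (3 * m + 1 + 2))
  rw [sum_indepSet_cycleGraph, (pathSum_values m).1, (pathSum_values m).2] at h
  have h2 : |(-(-1) ^ m - (-1) ^ m : ℤ)| = 2 := by
    rcases neg_one_pow_eq_or ℤ m with h | h <;> rw [h] <;> norm_num
  rw [h2] at h
  have : (2 : ℤ) ≤ ((cycleGraph (3 * m + 1 + 2)).bettiSum : ℤ) := h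
  omega

end SimpleGraph

theorem mainTheorem1 :
    ∃ c : ℕ, ∀ (V : Type*) (G : SimpleGraph V),
      (G.IsTrinity → G.chromaticNumber ≤ (c : ℕ∞)) ∧
      ((c : ℕ∞) < G.chromaticNumber →
        ∃ (n : ℕ) (H : SimpleGraph (Fin n)), H.IsIndContained G ∧ 1 < H.bettiSum) := by
  refine ⟨SimpleGraph.graphBound (SimpleGraph.graphBound 1 + 1), fun V G =>
    ⟨fun hG => hG.colorable.chromaticNumber_le, fun h => ?_⟩⟩
  have hG : ¬ G.IsTrinity := fun hG => not_lt.2 hG.colorable.chromaticNumber_le h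
  unfold SimpleGraph.IsTrinity at hG
  push Not at hG
  obtain ⟨k, hk, h3, hind⟩ := hG
  exact ⟨k, SimpleGraph.cycleGraph k, hind, SimpleGraph.one_lt_bettiSum_cycleGraph hk h3⟩
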